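/- Fix an integer $k\ge 2$. A $k$-ary transducer is a tuple $\mathcal A=(Q,\Sigma_1,\dots,\Sigma_k,q_0,\Delta,F)$ with a finite state set $Q$, finite non-empty alphabets $\Sigma_1,\dots,\Sigma_k$, an initial state $q_0\in Q$, a transition relation $\Delta\subseteq Q\times(\Sigma_1\cup\{\varepsilon\})\times\dots\times(\Sigma_k\cup\{\varepsilon\})\times Q$ and a set $F\subseteq Q$ of accepting states. It is deterministic if there is a partition $Q=Q_1\cup\dots\cup Q_k$ (blocks may be empty) such that $\Delta$ is given by a partial function $\delta:\bigcup_{j=1}^k\bigl(Q_j\times(\Sigma_j\cup\{\varepsilon\})\bigr)\to Q$ (a transition from a state of $Q_j$ reads $\varepsilon$ in every component other than $j$), where, if $\delta(q,\varepsilon)$ is defined, then $\delta(q,a)$ is undefined for all $a\ne\varepsilon$. Used as a Büchi transducer, $\mathcal A$ defines the relation $R_\omega(\mathcal A)\subseteq\Sigma_1^\omega\times\dots\times\Sigma_k^\omega$ of all tuples $(u_1,\dots,u_k)$ of infinite words for which there are an infinite sequence of states $p_0p_1p_2\cdots$ with $p_0=q_0$ and labels $a_{i,j}\in\Sigma_j\cup\{\varepsilon\}$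 ($i\ge 1$, $1\le j\le k$) such that $(p_{i-1},a_{i,1},\dots,a_{i,k},p_i)\in\Delta$ for all $i\ge1$, $u_j=a_{1,j}a_{2,j}a_{3,j}\cdots$ for every $j$, and some state of $F$ occurs infinitely often in $p_0p_1p_2\cdots$. Then, for every $k\ge2$, the equivalence problem for $k$-ary deterministic Büchi transducers is undecidable: there is no algorithm that, given (finite descriptions of) two $k$-ary deterministic Büchi transducers $\mathcal A$ and $\mathcal B$ over the same alphabets $\Sigma_1,\dots,\Sigma_k$, always halts and decides whether $R_\omega(\mathcal A)=R_\omega(\mathcal B)$. -/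

import Mathlib

/-- A (nondeterministic) `k`-ary finite transducer `(Q, A₁, …, A_k, q₀, Δ, F)` with state set `Q` and
alphabets `A j`. In a transition label, `none` is the empty word `ε` and `some x` is the letter `x`. -/
structure Transducer {k : ℕ} (Q : Type) (A : Fin k → Type) where
  /-- the initial state `q₀` -/
  init : Q
  /-- the transition relation `Δ ⊆ Q × (A₁ ∪ {ε}) × ⋯ × (A_k ∪ {ε}) × Q` -/
  step : Set (Q × (∀ j, Option (A j)) × Q)
  /-- the set `F` of accepting states -/
  final : Set Q

namespace Transducer

variable {k : ℕ} {Q : Type} {A : Fin k → Type}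

/-- A transducer is deterministic if its states can be partitioned as `Q = Q₁ ∪ ⋯ ∪ Q_k` (here `q`
lies in the block with index `comp q`) such that the transition relation is a partial function `δ`
on the pairs `(q, a)` with `q ∈ Q_j` and `a ∈ A_j ∪ {ε}` (a state of `Q_j` reads in component `j`
only), where `δ (q, a)` is undefined for every letter `a` whenever `δ (q, ε)` is defined. -/
def IsDeterministic (T : Transducer Q A) : Prop :=
  ∃ (comp : Q → Fin k) (δ : (q : Q) → Option (A (comp q)) → Option Q),
    (∀ q, δ q none ≠ none → ∀ x, δ q (some x) = none) ∧
    ∀ p a q, (p, a, q) ∈ T.step ↔ (∀ j, j ≠ comp p → a j = none) ∧ δ p (a (comp p)) = some q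

/-- The infinite sequence `a` of letters and empty words has as its concatenation the infinite word
`w`: the `n`-th letter of `w` is read at time `t n`, and `ε` is read at all other times. -/
def Spells {B : Type} (a : ℕ → Option B) (w : ℕ → B) : Prop :=
  ∃ t : ℕ → ℕ, StrictMono t ∧ (∀ n, a (t n) = some (w n)) ∧ ∀ i, i ∉ Set.range t → a i = none

/-- `ρ` is an infinite run of `T` on the tuple `u` of infinite words: `u` decomposes as
`(a 0) (a 1) (a 2) ⋯` with a transition of `T` from `ρ i` to `ρ (i + 1)` labelled `a i` for all `i`. -/
def IsRun (T : Transducer Q A) (u : ∀ j, ℕ → A j) (ρ : ℕ → Q) : Prop :=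
  ∃ a : ℕ → ∀ j, Option (A j),
    (∀ j, Spells (fun i => a i j) (u j)) ∧ ∀ i, (ρ i, a i, ρ (i + 1)) ∈ T.step

/-- The relation over infinite words defined by `T` as a Büchi transducer: the tuples having a run
that starts in the initial state and visits some accepting state infinitely often. -/
def omegaRel (T : Transducer Q A) : Set (∀ j, ℕ → A j) :=
  {u | ∃ ρ : ℕ → Q, T.IsRun u ρ ∧ ρ 0 = T.init ∧ ∃ f ∈ T.final, {i | ρ i = f}.Infinite}

end Transducer

/-- Finite descriptions of `k`-ary transducers with states and letters named by natural numbers: the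
number of states, the initial state, a list of the transitions, a list of the accepting states. -/
abbrev TransducerCode (k : ℕ) : Type :=
  ℕ × ℕ × List (ℕ × (Fin k → Option ℕ) × ℕ) × List ℕ

/-- `c` describes the transducer `T` with states `0, …, n - 1` and alphabets `{0, …, m j - 1}`
(the order and multiplicity of entries in the two lists are irrelevant). -/
def IsCodeOf {k n : ℕ} {m : Fin k → ℕ} (c : TransducerCode k)
    (T : Transducer (Fin n) (fun j => Fin (m j))) : Prop :=
  c.1 = n ∧ c.2.1 = (T.init : ℕ) ∧
  (∀ e, e ∈ c.2.2.1 ↔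
    ∃ p a q, (p, a, q) ∈ T.step ∧ e = ((p : ℕ), (fun j => (a j).map Fin.val), (q : ℕ))) ∧
  ∀ s, s ∈ c.2.2.2 ↔ ∃ q ∈ T.final, s = (q : ℕ)

/-- The equivalence problem for `k`-ary deterministic Büchi transducers is decidable: some algorithm,
given sizes of `k` nonempty alphabets and descriptions of two deterministic Büchi transducers over
these alphabets, always halts and tells correctly whether they define the same relation.
(No requirement is made on the answers to inputs that are not of this form.) -/
def BuchiEquivalenceDecidable (k : ℕ) : Prop :=
  ∃ decider : (Fin k → ℕ) × TransducerCode k × TransducerCode k → Bool,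
    Computable decider ∧
    ∀ (m : Fin k → ℕ) (n₁ n₂ : ℕ)
      (T₁ : Transducer (Fin n₁) (fun j => Fin (m j)))
      (T₂ : Transducer (Fin n₂) (fun j => Fin (m j)))
      (c₁ c₂ : TransducerCode k),
      (∀ j, 0 < m j) → T₁.IsDeterministic → T₂.IsDeterministic →
      IsCodeOf c₁ T₁ → IsCodeOf c₂ T₂ →
      (decider (m, c₁, c₂) = true ↔ T₁.omegaRel = T₂.omegaRel)

/-!
The proof reduces the halting problem to inequivalence of deterministic Büchi transducers.

*From tests to transducers.* Suppose that two deterministic two-tape automata test pairs `(y, z)` of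
finite words, and that it is undecidable whether some pair passes both tests. Let the first two tapes
carry infinitely many blocks `y`, `z`, separated by an end marker, and let a transducer apply one of
the tests to each block: after a success it keeps the test, after a failure it takes the other test
for the next block. It accepts if it begins infinitely many blocks with the second test. Consider this
transducer once started with the first test and once started with the second one. If no pair passes
both tests, then at each block either exactly one test succeeds, and from then on the two runs
coincide, or both tests fail, and the two runs exchange their tests; so in the limit either the runs
coincide or both of them apply the second test infinitely often, and the two relations are equal
(`BlockMachine.accepts_false_iff_accepts_true`). If `(y, z)` passes both tests, then on the periodic
repetition of this block each run keeps its test for ever, only the second one accepts, and the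
relations differ (`BlockMachine.exists_accepts_true_not_accepts_false`). Whatever happens inside of a
block, its end is found at the same positions, so that the two runs are at the same positions at the
beginning of each block (`BlockMachine.go_block`). An incomplete block is never left and leads to
rejection (`BlockMachine.never_starts`). After each block one letter is read on every tape, which takes
care of the components other than the first two.

*The tests.* As for Post's correspondence problem, the tests are given by two morphisms `g`, `h`: the
first test is that `z` begins with `w h(y)`, the second one that it begins with `g(y) tick`. The word
`y` is a sequence of tiles which acts on a queue with initial content `w`: a tile `t` removes `g(t)` at
the front and appends `h(t)` at the end, and both tests succeed if the letter `tick` finally arrives at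
the front. The contents of the queue are rotations of words `# u [q,a] v` that describe
configurations of a Turing machine; tiles can copy letters, insert blanks next to `#`, and rewrite the
surroundings of the scanned cell `[q,a]`, producing `tick` if the machine halts. Thus some pair passes
both tests if and only if the machine halts (`TileLetter.eval_dom_iff_exists_prefix`).

*The input.* The Turing machine is fixed: it is obtained from a partial recursive function whose domain
is undecidable already among the powers of two. The binary representation of `2 ^ n` is a word of the
form `1 0ⁿ`, and so only a chain of `n` states, which compares `n` copies of one letter, depends on the
input `n`. Therefore the descriptions of the two transducers are computable from `n`
(`BlockMachine.computable_code`).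
-/

set_option linter.unusedSectionVars false

/-! ### A Turing machine with an undecidable halting problem on unary inputs -/

open Turing in
/-- The binary representation of `2 ^ j`, least significant digit first. -/
theorem trNat_two_pow (j : ℕ) :
    PartrecToTM2.trNat (2 ^ j) =
      List.replicate j PartrecToTM2.Γ'.bit0 ++ [PartrecToTM2.Γ'.bit1] := by
  have key : ∃ p : PosNum, ((2 ^ j : ℕ) : Num) = Num.pos p ∧
      PartrecToTM2.trPosNum p =
        List.replicate j PartrecToTM2.Γ'.bit0 ++ [PartrecToTM2.Γ'.bit1] := by
    induction j with
    | zero => exact ⟨PosNum.one, rfl, rfl⟩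
    | succ j ih =>
      obtain ⟨p, hp, hl⟩ := ih
      refine ⟨p.bit0, ?_, ?_⟩
      · rw [pow_succ, mul_two, Nat.cast_add, hp]
        exact Num.bit0_of_bit0 _
      · simp [PartrecToTM2.trPosNum, hl, List.replicate_succ]
  obtain ⟨p, hp, hl⟩ := key
  rw [PartrecToTM2.trNat, hp, PartrecToTM2.trNum, hl]

instance : Finite Turing.PartrecToTM2.K' :=
  Finite.of_surjective
    (fun i : Fin 4 => ![Turing.PartrecToTM2.K'.main, .rev, .aux, .stack] i) (by
      rintro (_ | _ | _ | _)
      exacts [⟨0, rfl⟩, ⟨1, rfl⟩, ⟨2, rfl⟩, ⟨3, rfl⟩])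

/-- Some partial recursive function has a domain that is not computable among the powers of two. -/
theorem exists_code_two_pow_not_computable :
    ∃ c : Turing.ToPartrec.Code, ¬ ComputablePred fun j : ℕ => (c.eval [2 ^ j]).Dom := by
  -- `f (2 ^ j)` runs the program with number `j`
  let f : ℕ →. ℕ := fun m =>
    (Nat.rfind fun j => Part.some (decide (2 ^ j = m))) >>= fun j =>
      (Denumerable.ofNat Nat.Partrec.Code j).eval 0
  have hpow : Primrec₂ fun a b : ℕ => a ^ b := by
    have := Nat.Primrec.pow
    exact Primrec₂.unpaired'.1 this
  have hf : Partrec f := by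
    refine Partrec.bind (Partrec.rfind ?_) ?_
    · have h : PrimrecPred fun p : ℕ × ℕ => 2 ^ p.2 = p.1 :=
        Primrec.eq.comp (hpow.comp (Primrec.const 2) Primrec.snd) Primrec.fst
      exact h.decide.to_comp.partrec
    · exact Nat.Partrec.Code.eval_part.comp
        ((Computable.ofNat _).comp Computable.snd) (Computable.const 0)
  obtain ⟨c, hc⟩ := Turing.ToPartrec.Code.exists_code (Nat.Partrec'.part_iff₁.2 hf)
  have hdom : ∀ j : ℕ, (c.eval [2 ^ j]).Dom ↔
      ((Denumerable.ofNat Nat.Partrec.Code j).eval 0).Dom := by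
    intro j
    have h1 : c.eval [2 ^ j] = pure <$> f (2 ^ j) := hc ⟨[2 ^ j], rfl⟩
    have h2 : (Nat.rfind fun i => Part.some (decide (2 ^ i = 2 ^ j))) = Part.some j := by
      refine Part.eq_some_iff.2 (Nat.mem_rfind.2 ⟨by simp, fun {m} hm => ?_⟩)
      have : (2 : ℕ) ^ m ≠ 2 ^ j := (Nat.pow_lt_pow_right (by norm_num) hm).ne
      simp [this]
    have h3 : f (2 ^ j) = (Denumerable.ofNat Nat.Partrec.Code j).eval 0 := by
      change (Nat.rfind fun i => Part.some (decide (2 ^ i = 2 ^ j))) >>= _ = _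
      rw [h2]
      exact Part.bind_some _ _
    rw [h1, h3]
    exact Iff.rfl
  refine ⟨c, fun h => ComputablePred.halting_problem 0 ?_⟩
  simp only [hdom] at h
  refine ComputablePred.of_eq (p := fun x =>
    ((Denumerable.ofNat Nat.Partrec.Code (Encodable.encode x)).eval 0).Dom) ?_ (fun x => by simp)
  obtain ⟨g, hg, hp⟩ := ComputablePred.computable_iff.1 h
  refine ComputablePred.computable_iff.2 ⟨g ∘ Encodable.encode, hg.comp Computable.encode, ?_⟩
  funext x
  exact congrFun hp (Encodable.encode x)

open Turing in
/-- There is a Turing machine whose halting problem is undecidable on the inputs `x₀ x₁ cⁿ`, for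
three fixed symbols `x₀`, `x₁`, `c`. -/
theorem exists_turing_machine_halting_not_computable :
    ∃ (Γ Λ : Type) (_ : Inhabited Γ) (_ : Inhabited Λ) (_ : Finite Γ) (_ : Finite Λ)
      (M : TM0.Machine Γ Λ) (x₀ x₁ c : Γ),
      ¬ ComputablePred fun n : ℕ =>
        (StateTransition.eval (TM0.step M) (TM0.init (x₀ :: x₁ :: List.replicate n c))).Dom := by
  classical
  obtain ⟨code, hcode⟩ := exists_code_two_pow_not_computable
  -- the initial label of the stack machine has to be the default one
  let inst : Inhabited PartrecToTM2.Λ' := ⟨PartrecToTM2.trNormal code PartrecToTM2.Cont'.halt⟩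
  let S₂ := PartrecToTM2.codeSupp code PartrecToTM2.Cont'.halt
  have sup₂ : TM2.Supports PartrecToTM2.tr S₂ :=
    PartrecToTM2.tr_supports code PartrecToTM2.Cont'.halt
  let M₁ := TM2to1.tr PartrecToTM2.tr
  have sup₁ : TM1.Supports M₁ _ := TM2to1.tr_supports PartrecToTM2.tr sup₂
  let M₀ := TM1to0.tr M₁
  have sup₀ : TM0.Supports M₀ _ := TM1to0.tr_supports M₁ sup₁
  let S := TM1to0.trStmts M₁ (TM2to1.trSupp PartrecToTM2.tr S₂)
  let G := TM2to1.Γ' PartrecToTM2.K' (fun _ => PartrecToTM2.Γ')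
  -- restriction to the finite set of states that are used
  let Q := {q : TM1to0.Λ' M₁ // q ∈ S}
  let iQ : Inhabited Q := ⟨⟨default, sup₀.1⟩⟩
  let g₁ : PointedMap (TM1to0.Λ' M₁) Q :=
    ⟨fun q => if h : q ∈ S then ⟨q, h⟩ else default, dif_pos sup₀.1⟩
  let fid : PointedMap G G := ⟨id, rfl⟩
  let M : TM0.Machine G Q := M₀.map fid fid g₁ Subtype.val
  have resp := TM0.Machine.map_respects M₀ fid fid g₁ (Subtype.val : Q → _) (S := S) sup₀
    (fun _ => rfl) (fun q hq => by simp [g₁, Finset.mem_coe.1 hq])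
  have hG : Finite G := by
    have : Finite (Bool × (PartrecToTM2.K' → Option PartrecToTM2.Γ')) := inferInstance
    exact this
  -- the tape symbol that has `a` on the input stack and nothing on the others
  let bit (a : PartrecToTM2.Γ') : PartrecToTM2.K' → Option PartrecToTM2.Γ' :=
    Function.update (fun _ => none) PartrecToTM2.K'.main (some a)
  refine ⟨G, Q, inferInstance, iQ, hG, inferInstance, M, (true, bit .cons), (false, bit .bit1),
    (false, bit .bit0), ?_⟩
  have hdom : ∀ n : ℕ, (StateTransition.eval (TM0.step M) (TM0.init
      (((true, bit .cons) : G) :: (false, bit .bit1) :: List.replicate n (false, bit .bit0)))).Dom ↔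
      (code.eval [2 ^ n]).Dom := by
    intro n
    set l : List G := ((true, bit .cons) : G) :: (false, bit .bit1) ::
      List.replicate n (false, bit .bit0) with hl
    have e1 := StateTransition.tr_eval_dom resp (a₁ := TM0.init l) (a₂ := TM0.init l)
      ⟨sup₀.1, by rw [TM0.map_init]; simp [fid]⟩
    have e2 := StateTransition.tr_eval_dom (TM1to0.tr_respects M₁) (a₁ := TM1.init l)
      (a₂ := TM0.init l) rfl
    have hl' : l = TM2to1.trInit PartrecToTM2.K'.main (PartrecToTM2.trList [2 ^ n]) := by
      simp [hl, TM2to1.trInit, PartrecToTM2.trList, trNat_two_pow, bit]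
      change _ = (true, bit .cons) :: (false, bit .bit1) :: List.map _ (List.replicate n _)
      rw [List.map_replicate]
      rfl
    have e3 := StateTransition.tr_eval_dom (TM2to1.tr_respects PartrecToTM2.tr)
      (TM2to1.trCfg_init PartrecToTM2.K'.main (PartrecToTM2.trList [2 ^ n]))
    have hinit : (TM2.init PartrecToTM2.K'.main (PartrecToTM2.trList [2 ^ n]) :
        TM2.Cfg (fun _ : PartrecToTM2.K' => PartrecToTM2.Γ') PartrecToTM2.Λ' (Option PartrecToTM2.Γ'))
        = PartrecToTM2.init code [2 ^ n] := by
      unfold TM2.init PartrecToTM2.init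
      congr 1
      funext k
      cases k <;> rfl
    rw [e1, e2, hl', e3, hinit, PartrecToTM2.tr_eval]
    exact Iff.rfl
  simpa only [hdom] using hcode

/-! ### Simulation of a Turing machine by a tile system -/

open Turing

/-- Letters of the tile system of a Turing machine. The letters `hash`, `cell a`, `head q a` and
`tick` make up circular words `# u [q,a] v`, in which `[q,a]` is the scanned cell together with the
state; each of them is also the tile that copies it. The other letters only name tiles: `padLeft` and
`padRight` insert a blank at either end of the tape, and `act q a b` executes the instruction of the
state `q` at the symbol `a`, next to the symbol `b` in case of a move. -/
inductive TileLetter (Γ Λ : Type) : Type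
  | hash
  | cell (a : Γ)
  | head (q : Λ) (a : Γ)
  | tick
  | padLeft
  | padRight
  | act (q : Λ) (a b : Γ)

namespace TileLetter

variable {Γ Λ : Type}

instance [Finite Γ] [Finite Λ] : Finite (TileLetter Γ Λ) :=
  Finite.of_surjective
    (fun x : (Fin 4 ⊕ Γ) ⊕ ((Λ × Γ) ⊕ (Λ × Γ × Γ)) =>
      match x with
      | .inl (.inl i) => ![hash, tick, padLeft, padRight] i
      | .inl (.inr a) => cell a
      | .inr (.inl (q, a)) => head q a
      | .inr (.inr (q, a, b)) => act q a b) (by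
    rintro (_ | a | ⟨q, a⟩ | _ | _ | _ | ⟨q, a, b⟩)
    exacts [⟨.inl (.inl 0), rfl⟩, ⟨.inl (.inr a), rfl⟩, ⟨.inr (.inl (q, a)), rfl⟩,
      ⟨.inl (.inl 1), rfl⟩, ⟨.inl (.inl 2), rfl⟩, ⟨.inl (.inl 3), rfl⟩,
      ⟨.inr (.inr (q, a, b)), rfl⟩])

variable [Inhabited Γ] [Inhabited Λ]

/-- The word that a tile removes from the front of the queue. -/
def consume (M : TM0.Machine Γ Λ) : TileLetter Γ Λ → List (TileLetter Γ Λ)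
  | padLeft => [hash]
  | padRight => [hash]
  | act q a b =>
    match M q a with
    | some (_, .move .right) => [head q a, cell b]
    | some (_, .move .left) => [cell b, head q a]
    | _ => [head q a]
  | t => [t]

/-- The word that a tile appends at the end of the queue. -/
def produce (M : TM0.Machine Γ Λ) : TileLetter Γ Λ → List (TileLetter Γ Λ)
  | padLeft => [hash, cell default]
  | padRight => [cell default, hash]
  | act q a b =>
    match M q a with
    | none => [tick]
    | some (q', .write a') => [head q' a']
    | some (q', .move .right) => [cell a, head q' b]
    | some (q', .move .left) => [head q' b, cell a]
  | t => [t]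

theorem length_consume_le_two (M : TM0.Machine Γ Λ) (t : TileLetter Γ Λ) :
    (consume M t).length ≤ 2 := by
  cases t <;> simp only [consume, List.length_cons, List.length_nil] <;> try omega
  split <;> simp

theorem length_produce_le_two (M : TM0.Machine Γ Λ) (t : TileLetter Γ Λ) :
    (produce M t).length ≤ 2 := by
  cases t <;> simp only [produce, List.length_cons, List.length_nil] <;> try omega
  split <;> simp

theorem length_consume_le_length_produce (M : TM0.Machine Γ Λ) (t : TileLetter Γ Λ) :
    (consume M t).length ≤ (produce M t).length := by
  cases t with
  | act q a b =>
    simp only [consume, produce]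
    rcases M q a with _ | ⟨q', (_ | _) | a'⟩ <;> simp
  | _ => simp [consume, produce]

/-- One application of a tile to a queue: it consumes at the front and produces at the end. -/
def QueueStep (M : TM0.Machine Γ Λ) (w w' : List (TileLetter Γ Λ)) : Prop :=
  ∃ t r, w = consume M t ++ r ∧ w' = r ++ produce M t

/-- The circular word `# u [q,a] v`, cut before the letter `[q,a]`. -/
def conf (q : Λ) (a : Γ) (u v : List Γ) : List (TileLetter Γ Λ) :=
  head q a :: (v.map cell ++ hash :: u.map cell)

/-- The queue `w` is a rotation of the circular word of the configuration `c`, for some finite part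
of its tape outside of which all cells are blank. -/
def Represents (w : List (TileLetter Γ Λ)) (c : TM0.Cfg Γ Λ) : Prop :=
  ∃ u v, w ~r conf c.q c.Tape.head u v ∧
    c.Tape.left = ListBlank.mk u.reverse ∧ c.Tape.right = ListBlank.mk v

/-- Rotated words coincide if they begin with the only letter that satisfies `p`. -/
theorem _root_.List.IsRotated.eq_of_forall_not {α : Type*} {p : α → Prop} {x x' : α}
    {l l' : List α} (h : x :: l ~r x' :: l') (hx' : p x') (hl : ∀ y ∈ l, ¬ p y) :
    x = x' ∧ l = l' := by
  obtain ⟨n, hn⟩ := h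
  rw [List.rotate_eq_drop_append_take_mod] at hn
  have hlt : n % (x :: l).length < (x :: l).length := Nat.mod_lt _ (by simp)
  generalize n % (x :: l).length = m at hn hlt
  cases m with
  | zero => simpa using hn
  | succ m =>
    have hm : m < l.length := by simpa using hlt
    rw [List.drop_succ_cons, List.drop_eq_getElem_cons hm, List.cons_append, List.cons.injEq] at hn
    exact absurd hx' (hn.1 ▸ hl _ (List.getElem_mem hm))

theorem _root_.Turing.ListBlank.mk_append_default (l : List Γ) :
    ListBlank.mk (l ++ [default]) = ListBlank.mk l :=
  (Quotient.sound (Or.inl ⟨1, rfl⟩ : BlankRel l (l ++ [default]))).symm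

/-- Applying a tile to a queue that represents a configuration leads to a representation of the same
configuration or of the next one, unless the machine has halted. -/
theorem Represents.of_queueStep {M : TM0.Machine Γ Λ} {w w' : List (TileLetter Γ Λ)}
    {c : TM0.Cfg Γ Λ} (hw : Represents w c) (h : QueueStep M w w') :
    Represents w' c ∨ TM0.step M c = none ∨ ∃ c', TM0.step M c = some c' ∧ Represents w' c' := by
  obtain ⟨u, v, hrot, hl, hr⟩ := hw
  obtain ⟨q, ⟨a, L, R⟩⟩ := c
  simp only at hl hr hrot
  subst hl hr
  obtain ⟨t, r, rfl, rfl⟩ := h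
  have hcomm : r ++ produce M t ~r produce M t ++ r := List.isRotated_append
  have hhash : conf q a u v ~r hash :: (u.map cell ++ head q a :: v.map cell) := by
    have := List.isRotated_append (l := head q a :: v.map cell) (l' := hash :: u.map cell)
    simpa [conf] using this
  -- the head letter is the only one of its kind, so that the rotation is determined by it
  have hhead : ∀ q' a' s, head q' a' :: s ~r conf q a u v → q' = q ∧ a' = a ∧
      s = v.map cell ++ hash :: u.map cell := by
    intro q' a' s hs
    have := List.IsRotated.eq_of_forall_not (p := fun y => ∃ q a, y = head q a) hs.symm
      ⟨_, _, rfl⟩ (by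
        intro y hy
        simp only [List.mem_append, List.mem_map, List.mem_cons] at hy
        rcases hy with ⟨b, -, rfl⟩ | rfl | ⟨b, -, rfl⟩ <;> simp)
    simp only [head.injEq] at this
    exact ⟨this.1.1.symm, this.1.2.symm, this.2.symm⟩
  have hpad : ∀ s, hash :: s ~r conf q a u v → s = u.map cell ++ head q a :: v.map cell := by
    intro s hs
    exact (List.IsRotated.eq_of_forall_not (p := fun y => y = hash) (hs.trans hhash).symm
      rfl (by
        intro y hy
        simp only [List.mem_append, List.mem_map, List.mem_cons] at hy
        rcases hy with ⟨b, -, rfl⟩ | rfl | ⟨b, -, rfl⟩ <;> simp)).2.symm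
  have hsingle : ∀ x : TileLetter Γ Λ, consume M t = [x] → produce M t = [x] →
      Represents (r ++ produce M t) ⟨q, ⟨a, ListBlank.mk u.reverse, ListBlank.mk v⟩⟩ := by
    intro x h1 h2
    rw [h1] at hrot
    exact ⟨u, v, by rw [h2] at hcomm ⊢; exact hcomm.trans hrot, rfl, rfl⟩
  cases t with
  | hash => exact .inl (hsingle _ rfl rfl)
  | cell b => exact .inl (hsingle _ rfl rfl)
  | head q' a' => exact .inl (hsingle _ rfl rfl)
  | tick => exact .inl (hsingle _ rfl rfl)
  | padLeft =>
    left
    have hr := hpad r hrot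
    refine ⟨default :: u, v, hcomm.trans ?_, by simp [ListBlank.mk_append_default], rfl⟩
    have := List.isRotated_append (l := hash :: cell default :: u.map cell)
      (l' := head q a :: v.map cell)
    simpa [conf, produce, hr] using this
  | padRight =>
    left
    have hr := hpad r hrot
    refine ⟨u, v ++ [default], hcomm.trans ?_, rfl, by simp [ListBlank.mk_append_default]⟩
    have := List.isRotated_append (l := cell default :: hash :: u.map cell)
      (l' := head q a :: v.map cell)
    simpa [conf, produce, hr] using this
  | act q' a' b =>
    right
    rcases hM : M q' a' with _ | ⟨q'', (_ | _) | a''⟩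
    · simp only [consume, hM] at hrot
      obtain ⟨rfl, rfl, -⟩ := hhead _ _ _ hrot
      exact .inl (by simp [TM0.step, hM])
    · simp only [consume, hM] at hrot
      simp only [produce, hM] at hcomm ⊢
      have hrot' : head q' a' :: (r ++ [cell b]) ~r conf q a u v :=
        (List.isRotated_append (l := [head q' a'] ++ r) (l' := [cell b])).trans hrot
      obtain ⟨rfl, rfl, hs⟩ := hhead _ _ _ hrot'
      right
      rcases List.eq_nil_or_concat u with rfl | ⟨u, b', rfl⟩
      · simpa using congrArg List.getLast? hs
      · have hs' : r ++ [cell b] = (v.map cell ++ hash :: u.map cell) ++ [cell b'] := by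
          simpa using hs
        obtain ⟨rfl, hb⟩ := List.append_inj' hs' rfl
        obtain rfl : b = b' := by simpa using hb
        refine ⟨⟨q'', ⟨b, ListBlank.mk u.reverse, ListBlank.mk (a' :: v)⟩⟩,
          by simp [TM0.step, hM, Tape.move], u, a' :: v, ?_, rfl, rfl⟩
        simpa [conf] using hcomm
    · simp only [consume, hM] at hrot
      simp only [produce, hM] at hcomm ⊢
      obtain ⟨rfl, rfl, hs⟩ := hhead _ _ _ hrot
      right
      rcases v with _ | ⟨b', v⟩
      · simp at hs
      · simp only [List.map_cons, List.cons_append] at hs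
        obtain ⟨rfl, rfl⟩ := hs
        refine ⟨⟨q'', ⟨b, ListBlank.mk (u ++ [a']).reverse, ListBlank.mk v⟩⟩,
          by simp [TM0.step, hM, Tape.move], u ++ [a'], v, hcomm.trans ?_, rfl, rfl⟩
        have := List.isRotated_append (l := [cell a'])
          (l' := head q'' b :: (v.map cell ++ hash :: u.map cell))
        simpa [conf] using this
    · simp only [consume, hM] at hrot
      simp only [produce, hM] at hcomm ⊢
      obtain ⟨rfl, rfl, rfl⟩ := hhead _ _ _ hrot
      right
      exact ⟨⟨q'', ⟨a'', ListBlank.mk u.reverse, ListBlank.mk v⟩⟩,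
        by simp [TM0.step, hM, Tape.write], u, v, hcomm, rfl, rfl⟩

theorem Represents.length_ge_two {w : List (TileLetter Γ Λ)} {c : TM0.Cfg Γ Λ}
    (h : Represents w c) : 2 ≤ w.length := by
  obtain ⟨u, v, hrot, -⟩ := h
  rw [hrot.perm.length_eq]
  simp [conf]
  omega

theorem Represents.tick_notMem {w : List (TileLetter Γ Λ)} {c : TM0.Cfg Γ Λ}
    (h : Represents w c) : tick ∉ w := by
  obtain ⟨u, v, hrot, -⟩ := h
  rw [hrot.perm.mem_iff]
  simp [conf]

/-- Soundness of the simulation: a sequence of tiles that brings `tick` to the front of the queue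
witnesses that the machine halts. Since the queue always has at least two letters, each tile finds the
word that it consumes in the queue and not only in the word that it produces. -/
theorem eval_dom_of_prefix (M : TM0.Machine Γ Λ) (ts : List (TileLetter Γ Λ)) :
    ∀ (w : List (TileLetter Γ Λ)) (c : TM0.Cfg Γ Λ), Represents w c →
      ts.flatMap (consume M) ++ [tick] <+: w ++ ts.flatMap (produce M) →
      (StateTransition.eval (TM0.step M) c).Dom := by
  induction ts with
  | nil =>
    intro w c hw h
    simp only [List.flatMap_nil, List.nil_append, List.append_nil] at h
    exact absurd (h.subset (by simp)) hw.tick_notMem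
  | cons t ts ih =>
    intro w c hw h
    rw [List.flatMap_cons, List.flatMap_cons, List.append_assoc] at h
    have hle : consume M t <+: w :=
      List.prefix_of_prefix_length_le ((List.prefix_append _ _).trans h)
        (List.prefix_append _ _)
        ((length_consume_le_two M t).trans hw.length_ge_two)
    obtain ⟨r, rfl⟩ := hle
    rw [List.append_assoc, List.prefix_append_right_inj, ← List.append_assoc r] at h
    rcases hw.of_queueStep ⟨t, r, rfl, rfl⟩ with h' | h' | ⟨c', hc', h'⟩
    · exact ih _ _ h' h
    · exact Part.dom_iff_mem.2
        ⟨c, StateTransition.mem_eval.2 ⟨Relation.ReflTransGen.refl, h'⟩⟩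
    · rw [StateTransition.reaches_eval (Relation.ReflTransGen.single hc')]
      exact ih _ _ h' h

/-- Copying tiles rotate the queue. -/
theorem reaches_rotate (M : TM0.Machine Γ Λ) {w w' : List (TileLetter Γ Λ)}
    (hw : ∀ x ∈ w, consume M x = [x] ∧ produce M x = [x]) (h : w ~r w') :
    Relation.ReflTransGen (QueueStep M) w w' := by
  obtain ⟨n, rfl⟩ := h
  induction n generalizing w with
  | zero => simpa using Relation.ReflTransGen.refl
  | succ n ih =>
    cases w with
    | nil => simpa using Relation.ReflTransGen.refl
    | cons x w =>
      rw [List.rotate_cons_succ]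
      refine Relation.ReflTransGen.head ?_
        (ih (w := w ++ [x]) fun y hy => hw y (by simpa [or_comm] using hy))
      obtain ⟨h1, h2⟩ := hw x (by simp)
      exact ⟨x, w, by simp [h1], by simp [h2]⟩

theorem reaches_of_isRotated_conf (M : TM0.Machine Γ Λ) {w w' : List (TileLetter Γ Λ)} {q : Λ} {a : Γ}
    {u v : List Γ} (h : w ~r conf q a u v) (h' : w' ~r conf q a u v) :
    Relation.ReflTransGen (QueueStep M) w w' := by
  refine reaches_rotate M (fun x hx => ?_) (h.trans h'.symm)
  rw [h.perm.mem_iff] at hx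
  simp only [conf, List.mem_cons, List.mem_append, List.mem_map] at hx
  rcases hx with rfl | ⟨b, -, rfl⟩ | rfl | ⟨b, -, rfl⟩ <;> exact ⟨rfl, rfl⟩

/-- A blank can be added at both ends of the represented part of the tape. -/
theorem reaches_pad (M : TM0.Machine Γ Λ) (q : Λ) (a : Γ) (u v : List Γ) :
    Relation.ReflTransGen (QueueStep M) (conf q a u v)
      (conf q a (default :: u) (v ++ [default])) := by
  have h1 : hash :: (u.map cell ++ head q a :: v.map cell) ~r conf q a u v := by
    have := List.isRotated_append (l := hash :: u.map cell) (l' := head q a :: v.map cell)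
    simpa [conf] using this
  have h2 : hash :: (cell default :: (u.map cell ++ head q a :: v.map cell)) ~r
      conf q a (default :: u) v := by
    have := List.isRotated_append (l := hash :: cell default :: u.map cell)
      (l' := head q a :: v.map cell)
    simpa [conf] using this
  have h3 : (u.map cell ++ head q a :: v.map cell) ++ [hash, cell default] ~r
      conf q a (default :: u) v := by
    refine List.IsRotated.trans List.isRotated_append ?_
    simpa using h2
  have h4 : (cell default :: (u.map cell ++ head q a :: v.map cell)) ++ [cell default, hash] ~r
      conf q a (default :: u) (v ++ [default]) := by
    have := List.isRotated_append (l := cell default :: u.map cell)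
      (l' := head q a :: v.map cell ++ [cell default, hash])
    simpa [conf] using this
  refine (reaches_of_isRotated_conf M (List.IsRotated.refl _) h1).trans ?_
  refine .head ⟨padLeft, _, rfl, rfl⟩ ?_
  refine (reaches_of_isRotated_conf M h3 h2).trans ?_
  refine .head ⟨padRight, _, rfl, rfl⟩ ?_
  exact reaches_of_isRotated_conf M h4 (List.IsRotated.refl _)

/-- Completeness of the simulation: the queue can follow a step of the machine. -/
theorem Represents.exists_reaches_of_step {M : TM0.Machine Γ Λ} {w : List (TileLetter Γ Λ)}
    {c c' : TM0.Cfg Γ Λ} (hw : Represents w c) (h : TM0.step M c = some c') :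
    ∃ w', Relation.ReflTransGen (QueueStep M) w w' ∧ Represents w' c' := by
  obtain ⟨u, v, hrot, hl, hr⟩ := hw
  obtain ⟨q, ⟨a, L, R⟩⟩ := c
  simp only at hl hr hrot
  subst hl hr
  -- after padding there is a cell on both sides of the head
  obtain ⟨b, v', hv⟩ : ∃ b v', v ++ [default] = b :: v' := by
    cases v with
    | nil => exact ⟨_, _, rfl⟩
    | cons b v => exact ⟨_, _, rfl⟩
  obtain ⟨u', b', hu⟩ : ∃ u' b', default :: u = u' ++ [b'] := by
    rcases List.eq_nil_or_concat u with rfl | ⟨u, b', rfl⟩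
    · exact ⟨[], _, rfl⟩
    · exact ⟨default :: u, b', by simp⟩
  have hR : ListBlank.mk v = ListBlank.mk (b :: v') := by
    rw [← hv, ListBlank.mk_append_default]
  have hL : ListBlank.mk u.reverse = ListBlank.mk (b' :: u'.reverse) := by
    rw [← ListBlank.mk_append_default u.reverse, ← List.reverse_cons, hu, List.reverse_append]
    rfl
  have hreach : Relation.ReflTransGen (QueueStep M) w (conf q a (u' ++ [b']) (b :: v')) := by
    rw [← hu, ← hv]
    exact (reaches_of_isRotated_conf M hrot (List.IsRotated.refl _)).trans (reaches_pad M q a u v)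
  rw [hL, hR] at h
  rcases hM : M q a with _ | ⟨q', (_ | _) | a'⟩
  · simp [TM0.step, hM] at h
  · simp only [TM0.step, hM, Option.map_some, Tape.move, Option.some.injEq] at h
    subst h
    have h1 : cell b' :: head q a :: ((b :: v').map cell ++ hash :: u'.map cell) ~r
        conf q a (u' ++ [b']) (b :: v') := by
      have := List.isRotated_append (l := [cell b'])
        (l' := head q a :: ((b :: v').map cell ++ hash :: u'.map cell))
      simpa [conf] using this
    refine ⟨_, (hreach.trans (reaches_of_isRotated_conf M (List.IsRotated.refl _) h1)).tail
      ⟨act q a b', (b :: v').map cell ++ hash :: u'.map cell, by simp [consume, hM], rfl⟩,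
      u', a :: b :: v', ?_, by simp, by simp⟩
    simp only [produce, hM]
    refine List.IsRotated.trans List.isRotated_append ?_
    simpa [conf] using List.IsRotated.refl _
  · simp only [TM0.step, hM, Option.map_some, Tape.move, Option.some.injEq] at h
    subst h
    refine ⟨_, hreach.tail
      ⟨act q a b, v'.map cell ++ hash :: (u' ++ [b']).map cell, by simp [consume, hM, conf], rfl⟩,
      u' ++ [b', a], v', ?_, by simp, by simp⟩
    simp only [produce, hM]
    have := List.isRotated_append (l := v'.map cell ++ hash :: (u' ++ [b', a]).map cell)
      (l' := [head q' b])
    simpa [conf] using this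
  · simp only [TM0.step, hM, Option.map_some, Tape.write, Option.some.injEq] at h
    subst h
    refine ⟨_, hreach.tail
      ⟨act q a b, (b :: v').map cell ++ hash :: (u' ++ [b']).map cell,
        by simp [consume, hM, conf], rfl⟩,
      u' ++ [b'], b :: v', ?_, by simp, by simp⟩
    simp only [produce, hM]
    refine List.IsRotated.trans List.isRotated_append ?_
    simpa [conf] using List.IsRotated.refl _

theorem exists_tiles_of_reaches {M : TM0.Machine Γ Λ} {w w' : List (TileLetter Γ Λ)}
    (h : Relation.ReflTransGen (QueueStep M) w w') :
    ∃ ts : List (TileLetter Γ Λ),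
      w ++ ts.flatMap (produce M) = ts.flatMap (consume M) ++ w' := by
  induction h using Relation.ReflTransGen.head_induction_on with
  | refl => exact ⟨[], by simp⟩
  | head h _ ih =>
    obtain ⟨t, r, rfl, rfl⟩ := h
    obtain ⟨ts, hts⟩ := ih
    refine ⟨t :: ts, ?_⟩
    rw [List.flatMap_cons, List.flatMap_cons, List.append_assoc, List.append_assoc, ← hts,
      List.append_assoc]

theorem eval_dom_iff_exists_prefix (M : TM0.Machine Γ Λ) {w : List (TileLetter Γ Λ)}
    {c : TM0.Cfg Γ Λ} (hw : Represents w c) :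
    (StateTransition.eval (TM0.step M) c).Dom ↔
      ∃ ts : List (TileLetter Γ Λ),
        ts.flatMap (consume M) ++ [tick] <+: w ++ ts.flatMap (produce M) := by
  refine ⟨fun h => ?_, fun ⟨ts, h⟩ => eval_dom_of_prefix M ts w c hw h⟩
  obtain ⟨c', hc'⟩ := Part.dom_iff_mem.1 h
  obtain ⟨hreach, hhalt⟩ := StateTransition.mem_eval.1 hc'
  have key : ∃ w', Relation.ReflTransGen (QueueStep M) w w' ∧ Represents w' c' := by
    clear h hc' hhalt
    induction hreach with
    | refl => exact ⟨w, .refl, hw⟩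
    | tail _ hs ih =>
      obtain ⟨w₁, h₁, hw₁⟩ := ih
      obtain ⟨w₂, h₂, hw₂⟩ := hw₁.exists_reaches_of_step hs
      exact ⟨w₂, h₁.trans h₂, hw₂⟩
  obtain ⟨w', hww', u, v, hrot, -⟩ := key
  have hM : M c'.q c'.Tape.head = none := by
    obtain ⟨q, T⟩ := c'
    simpa [TM0.step] using hhalt
  set r : List (TileLetter Γ Λ) := v.map cell ++ hash :: u.map cell with hr
  have h1 : Relation.ReflTransGen (QueueStep M) w (r ++ [tick]) :=
    (hww'.trans (reaches_of_isRotated_conf M hrot (List.IsRotated.refl _))).tail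
      ⟨act c'.q c'.Tape.head default, r, by simp [consume, hM, conf, hr], by simp [produce, hM]⟩
  have h2 : Relation.ReflTransGen (QueueStep M) (r ++ [tick]) ([tick] ++ r) := by
    refine reaches_rotate M (fun x hx => ?_) List.isRotated_append
    simp only [hr, List.mem_cons, List.mem_append, List.mem_map, List.not_mem_nil, or_false] at hx
    rcases hx with (⟨b, -, rfl⟩ | rfl | ⟨b, -, rfl⟩) | rfl <;> exact ⟨rfl, rfl⟩
  obtain ⟨ts, hts⟩ := exists_tiles_of_reaches (h1.trans h2)
  exact ⟨ts, by rw [hts, ← List.append_assoc]; exact List.prefix_append _ _⟩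

end TileLetter

/-- Undecidability of a two-morphism prefix problem, in the manner of Post: for some finite alphabet,
two morphisms `g`, `h` and words `cⁿ pre` and `tick`, it is undecidable in `n` whether some word `z`
begins with both `g(ts) tick` and `cⁿ pre h(ts)` for a word `ts`. -/
theorem exists_tile_problem_not_computable :
    ∃ (Y : Type) (_ : Finite Y) (g h : Y → List Y) (c tick : Y) (pre : List Y),
      (∀ t, (g t).length ≤ 3) ∧ (∀ t, (h t).length ≤ 3) ∧ pre.length ≤ 3 ∧
      ¬ ComputablePred fun n : ℕ => ∃ ts z : List Y,
        (List.replicate n c ++ pre) ++ ts.flatMap h <+: z ∧ ts.flatMap g ++ [tick] <+: z := by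
  obtain ⟨Γ, Λ, _, _, _, _, M, x₀, x₁, c, hM⟩ := exists_turing_machine_halting_not_computable
  refine ⟨TileLetter Γ Λ, inferInstance, TileLetter.consume M, TileLetter.produce M,
    .cell c, .tick, [.hash, .head default x₀, .cell x₁],
    fun t => (TileLetter.length_consume_le_two M t).trans (by norm_num),
    fun t => (TileLetter.length_produce_le_two M t).trans (by norm_num), by simp, ?_⟩
  refine fun hc => hM (hc.of_eq fun n => ?_)
  have hrep : TileLetter.Represents (List.replicate n (.cell c) ++
      [.hash, .head default x₀, .cell x₁]) (TM0.init (x₀ :: x₁ :: List.replicate n c) :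
        TM0.Cfg Γ Λ) := by
    -- the queue is rotated so that the part depending on `n` comes first
    refine ⟨[], x₁ :: List.replicate n c, ?_, rfl, rfl⟩
    have := List.isRotated_append (l := List.replicate n (TileLetter.cell c) ++ [.hash])
      (l' := [(.head default x₀ : TileLetter Γ Λ), .cell x₁])
    simpa [TileLetter.conf, TM0.init, Tape.mk₁, Tape.mk₂, Tape.mk'] using this
  rw [TileLetter.eval_dom_iff_exists_prefix M hrep]
  constructor
  · rintro ⟨ts, z, h1, h2⟩
    -- no tile consumes more than it produces, so the consumed word cannot be the longer one
    refine ⟨ts, List.prefix_of_prefix_length_le h2 h1 ?_⟩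
    have : (ts.flatMap (TileLetter.consume M)).length ≤
        (ts.flatMap (TileLetter.produce M)).length := by
      simp only [List.length_flatMap]
      exact List.sum_le_sum fun t _ => TileLetter.length_consume_le_length_produce M t
    simp only [List.length_append, List.length_cons, List.length_nil]
    omega
  · rintro ⟨ts, h⟩
    exact ⟨ts, _, List.prefix_rfl, h⟩

/-! ### Deterministic machines as transducers -/

/-- A sequence of letters and empty words spells `w` if it contains infinitely many letters and each of
them is the letter of `w` whose position is the number of letters before it. -/
theorem Transducer.spells_iff {B : Type} (a : ℕ → Option B) (w : ℕ → B) :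
    Transducer.Spells a w ↔
      (∀ N, ∃ n, N ≤ Nat.count (fun i => (a i).isSome = true) n) ∧
        ∀ i x, a i = some x → x = w (Nat.count (fun i => (a i).isSome = true) i) := by
  set p : ℕ → Prop := fun i => (a i).isSome = true with hp
  constructor
  · rintro ⟨t, ht, hs, hn⟩
    have hran : Set.range t = {i | p i} := by
      ext i
      constructor
      · rintro ⟨n, rfl⟩
        change (a (t n)).isSome = true
        simp [hs]
      · intro hi
        by_contra hcon
        change (a i).isSome = true at hi
        simp [hn i hcon] at hi
    have hinf : ({i | p i}).Infinite := hran ▸ Set.infinite_range_of_injective ht.injective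
    have htn : t = Nat.nth p :=
      (StrictMono.range_inj ht (Nat.nth_strictMono hinf)).1
        (hran.trans (Nat.range_nth_of_infinite hinf).symm)
    refine ⟨fun N => ⟨t N, by rw [htn, Nat.count_nth_of_infinite hinf]⟩, fun i x hi => ?_⟩
    have hmem : i ∈ Set.range t := by
      rw [hran]
      change (a i).isSome = true
      simp [hi]
    obtain ⟨n, rfl⟩ := hmem
    have hc : Nat.count p (t n) = n := by rw [htn, Nat.count_nth_of_infinite hinf]
    rw [hc]
    exact Option.some_injective _ (hi.symm.trans (hs n))
  · rintro ⟨hub, hval⟩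
    have hinf : ({i | p i}).Infinite := by
      intro hfin
      obtain ⟨n, hn⟩ := hub (hfin.toFinset.card + 1)
      have : Nat.count p n ≤ hfin.toFinset.card := by
        rw [Nat.count_eq_card_filter_range]
        refine Finset.card_le_card fun i hi => ?_
        exact hfin.mem_toFinset.2 (Finset.mem_filter.1 hi).2
      change _ ≤ Nat.count p n at hn
      omega
    refine ⟨Nat.nth p, Nat.nth_strictMono hinf, fun n => ?_, fun i hi => ?_⟩
    · have hn : p (Nat.nth p n) := Nat.nth_mem_of_infinite hinf n
      obtain ⟨x, hx⟩ := Option.isSome_iff_exists.1 hn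
      rw [hx, hval _ x hx, Nat.count_nth_of_infinite hinf]
    · rw [Nat.range_nth_of_infinite hinf] at hi
      simpa [hp] using hi

/-- The control of a deterministic `k`-tape automaton that is never stuck: in a state `q` it either
moves silently to the state given by `eps q`, or, if there is none, reads a letter on the tape
`comp q` and moves according to `read q`. -/
structure ReadMachine (k : ℕ) (X Q : Type) where
  /-- the tape on which a state reads -/
  comp : Q → Fin k
  /-- the silent move from a state, if it has one -/
  eps : Q → Option Q
  /-- the move of a state without silent move, for each letter -/
  read : Q → X → Q

namespace ReadMachine

variable {k : ℕ} {X Q : Type}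

/-- One step on the tapes `u`; a configuration consists of a state and the head positions. -/
def step (D : ReadMachine k X Q) (u : Fin k → ℕ → X) (c : Q × (Fin k → ℕ)) : Q × (Fin k → ℕ) :=
  match D.eps c.1 with
  | some q => (q, c.2)
  | none => (D.read c.1 (u (D.comp c.1) (c.2 (D.comp c.1))),
      fun j => if j = D.comp c.1 then c.2 j + 1 else c.2 j)

/-- The configuration after `n` steps from the state `q`, with all heads at the beginning. -/
def run (D : ReadMachine k X Q) (u : Fin k → ℕ → X) (q : Q) (n : ℕ) : Q × (Fin k → ℕ) :=
  (D.step u)^[n] (q, fun _ => 0)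

theorem run_succ (D : ReadMachine k X Q) (u : Fin k → ℕ → X) (q : Q) (n : ℕ) :
    D.run u q (n + 1) = D.step u (D.run u q n) :=
  Function.iterate_succ_apply' _ _ _

open Classical in
/-- The transition function of a machine, in the form required of deterministic transducers: where a
silent move is defined, no reading move is. -/
noncomputable def delta (D : ReadMachine k X Q) (q : Q) : Option X → Option Q
  | none => D.eps q
  | some x => if D.eps q = none then some (D.read q x) else none

/-- The transducer given by a machine, an initial state and a set of accepting states. -/
def toTransducer (D : ReadMachine k X Q) (q₀ : Q) (F : Set Q) :
    Transducer Q (fun _ : Fin k => X) where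
  init := q₀
  step := {e | (∀ j, j ≠ D.comp e.1 → e.2.1 j = none) ∧
    D.delta e.1 (e.2.1 (D.comp e.1)) = some e.2.2}
  final := F

theorem isDeterministic_toTransducer (D : ReadMachine k X Q) (q₀ : Q) (F : Set Q) :
    (D.toTransducer q₀ F).IsDeterministic :=
  ⟨D.comp, D.delta, fun _ hq _ => if_neg hq, fun _ _ _ => Iff.rfl⟩

/-- The only candidate for an accepting run is the run of the machine; it is one if every tape is read
completely and some accepting state occurs infinitely often. -/
theorem mem_omegaRel_toTransducer (D : ReadMachine k X Q) (q₀ : Q) (F : Set Q)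
    (u : Fin k → ℕ → X) :
    u ∈ (D.toTransducer q₀ F).omegaRel ↔
      (∀ j N, ∃ n, N ≤ (D.run u q₀ n).2 j) ∧
        ∃ f ∈ F, {n | (D.run u q₀ n).1 = f}.Infinite := by
  constructor
  · rintro ⟨ρ, ⟨a, hsp, hstep⟩, h0, f, hf, hinf⟩
    simp only [Transducer.spells_iff] at hsp
    have hrun : ∀ n, D.run u q₀ n =
        (ρ n, fun j => Nat.count (fun i => (a i j).isSome = true) n) := by
      intro n
      induction n with
      | zero =>
        have : ρ 0 = q₀ := h0
        simp [run, this]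
      | succ n ih =>
        rw [run_succ, ih]
        obtain ⟨h1, h2⟩ := hstep n
        simp only at h1 h2
        unfold step
        cases he : D.eps (ρ n) with
        | some q =>
          have hnone : a n (D.comp (ρ n)) = none := by
            by_contra hcon
            obtain ⟨x, hx⟩ := Option.ne_none_iff_exists'.1 hcon
            rw [hx] at h2
            simp [delta, he] at h2
          rw [hnone, delta, he, Option.some.injEq] at h2
          simp only [Prod.mk.injEq]
          refine ⟨h2, funext fun j => ?_⟩
          have : a n j = none := by
            by_cases hj : j = D.comp (ρ n)
            · rw [hj, hnone]
            · exact h1 j hj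
          simp [Nat.count_succ, this]
        | none =>
          obtain ⟨x, hx⟩ : ∃ x, a n (D.comp (ρ n)) = some x := by
            refine Option.ne_none_iff_exists'.1 fun hcon => ?_
            rw [hcon] at h2
            simp [delta, he] at h2
          have hxu := (hsp (D.comp (ρ n))).2 n x hx
          rw [hx] at h2
          simp only [delta, he, if_true, Option.some.injEq] at h2
          simp only [Prod.mk.injEq]
          refine ⟨by rw [← h2, hxu], funext fun j => ?_⟩
          by_cases hj : j = D.comp (ρ n)
          · subst hj
            simp [Nat.count_succ, hx]
          · simp [Nat.count_succ, h1 j hj, hj]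
    refine ⟨fun j N => ?_, f, hf, ?_⟩
    · obtain ⟨n, hn⟩ := (hsp j).1 N
      exact ⟨n, by rw [hrun]; exact hn⟩
    · simpa [hrun] using hinf
  · rintro ⟨hub, f, hf, hinf⟩
    let a : ℕ → ∀ _ : Fin k, Option X := fun n j =>
      if D.eps (D.run u q₀ n).1 = none ∧ j = D.comp (D.run u q₀ n).1 then
        some (u j ((D.run u q₀ n).2 j)) else none
    have hcount : ∀ j n, Nat.count (fun i => (a i j).isSome = true) n = (D.run u q₀ n).2 j := by
      intro j n
      induction n with
      | zero => simp [run]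
      | succ n ih =>
        rw [Nat.count_succ, ih, run_succ, step]
        cases he : D.eps (D.run u q₀ n).1 with
        | some q => simp [a, he]
        | none =>
          by_cases hj : j = D.comp (D.run u q₀ n).1
          · simp [a, he, ← hj]
          · simp [a, hj]
    refine ⟨fun n => (D.run u q₀ n).1, ⟨a, fun j => ?_, fun n => ?_⟩, rfl, f, hf, hinf⟩
    · rw [Transducer.spells_iff]
      simp only [hcount]
      refine ⟨hub j, fun i x hx => ?_⟩
      simp only [a] at hx
      split at hx
      · exact (Option.some_injective _ hx).symm
      · simp at hx
    · refine ⟨fun j hj => by simp only [ne_eq] at hj; simp [a, hj], ?_⟩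
      simp only [run_succ, step]
      cases he : D.eps (D.run u q₀ n).1 <;> simp [a, he, delta]

/-- The machine obtained by renaming letters along `e`, and states along `enc` and `dec`. -/
def rename {X' Q' : Type} (D : ReadMachine k X Q) (e : X ≃ X') (enc : Q → Q') (dec : Q' → Q) :
    ReadMachine k X' Q' where
  comp q := D.comp (dec q)
  eps q := (D.eps (dec q)).map enc
  read q x := enc (D.read (dec q) (e.symm x))

theorem run_rename {X' Q' : Type} (D : ReadMachine k X Q) (e : X ≃ X') (enc : Q → Q')
    (dec : Q' → Q) (heps : ∀ q' q, D.eps (dec q') = some q → dec (enc q) = q)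
    (hread : ∀ q' x, dec (enc (D.read (dec q') x)) = D.read (dec q') x)
    (u : Fin k → ℕ → X') (q : Q') (n : ℕ) :
    (dec ((D.rename e enc dec).run u q n).1, ((D.rename e enc dec).run u q n).2) =
      D.run (fun j i => e.symm (u j i)) (dec q) n := by
  induction n with
  | zero => rfl
  | succ n ih =>
    rw [run_succ, run_succ, ← ih]
    generalize (D.rename e enc dec).run u q n = c
    unfold step
    cases he : D.eps (dec c.1) with
    | none =>
      simp only [rename, he, Option.map_none, hread]
      rfl
    | some q' => simp [rename, he, heps _ _ he]

end ReadMachine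

/-- `c'` is reached from `c` by iterating `step`, without meeting `S` strictly before `c'`. -/
inductive ReachesAvoiding {C : Type} (step : C → C) (S : Set C) : C → C → Prop
  | refl (c : C) : ReachesAvoiding step S c c
  | head {c c' : C} : c ∉ S → ReachesAvoiding step S (step c) c' → ReachesAvoiding step S c c'

namespace ReachesAvoiding

variable {C : Type} {step : C → C} {S : Set C}

theorem trans {a b c : C} (h : ReachesAvoiding step S a b) (h' : ReachesAvoiding step S b c) :
    ReachesAvoiding step S a c := by
  induction h with
  | refl => exact h'
  | head ha _ ih => exact .head ha (ih h')

theorem exists_iterate {a b : C} (h : ReachesAvoiding step S a b) :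
    ∃ n, step^[n] a = b ∧ ∀ m < n, step^[m] a ∉ S := by
  induction h with
  | refl c => exact ⟨0, rfl, by simp⟩
  | head ha _ ih =>
    obtain ⟨n, hn, hS⟩ := ih
    refine ⟨n + 1, hn, fun m hm => ?_⟩
    cases m with
    | zero => exact ha
    | succ m => exact hS m (by omega)

/-- If `V` lists successive returns to `S`, these are all visits to `S`: they take place at the times
given by some strictly increasing sequence. -/
theorem exists_strictMono_times {V : ℕ → C}
    (hV : ∀ n, ReachesAvoiding step S (step (V n)) (V (n + 1))) :
    ∃ τ : ℕ → ℕ, StrictMono τ ∧ (∀ n, step^[τ n] (V 0) = V n) ∧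
      ∀ m, m ∉ Set.range τ → step^[m] (V 0) ∉ S := by
  choose d hd hdS using fun n => (hV n).exists_iterate
  let τ : ℕ → ℕ := fun n => ∑ i ∈ Finset.range n, (d i + 1)
  have hsucc : ∀ n, τ (n + 1) = τ n + (d n + 1) := fun n => Finset.sum_range_succ _ _
  have hmono : StrictMono τ := strictMono_nat_of_lt_succ fun n => by rw [hsucc]; omega
  have hτ : ∀ n, step^[τ n] (V 0) = V n := by
    intro n
    induction n with
    | zero => rfl
    | succ n ih =>
      rw [hsucc, Nat.add_comm, Function.iterate_add_apply, ih, Function.iterate_succ_apply, hd]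
  refine ⟨τ, hmono, hτ, fun m hm => ?_⟩
  obtain ⟨n, h1, h2⟩ : ∃ n, τ n ≤ m ∧ m < τ (n + 1) := by
    have hex : ∃ n, m < τ n := ⟨m + 1, hmono.le_apply⟩
    classical
    have hspec := Nat.find_spec hex
    have hmin := fun i => Nat.find_min hex (m := i)
    cases hn : Nat.find hex with
    | zero => simp [hn, τ] at hspec
    | succ n => exact ⟨n, not_lt.1 (hmin n (by omega)), hn ▸ hspec⟩
  have h3 : τ n ≠ m := fun h => hm ⟨n, h⟩
  have h4 : m = (m - τ n - 1) + 1 + τ n := by omega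
  rw [h4, Function.iterate_add_apply, hτ, Function.iterate_succ_apply]
  exact hdS n _ (by rw [hsucc] at h2; omega)

theorem infinite_visits_iff {V : ℕ → C}
    (hV : ∀ n, ReachesAvoiding step S (step (V n)) (V (n + 1))) {T : Set C} (hT : T ⊆ S) :
    {m | step^[m] (V 0) ∈ T}.Infinite ↔ {n | V n ∈ T}.Infinite := by
  obtain ⟨τ, hmono, hτ, hout⟩ := exists_strictMono_times hV
  have : {m | step^[m] (V 0) ∈ T} = τ '' {n | V n ∈ T} := by
    ext m
    constructor
    · intro hm
      by_cases hr : m ∈ Set.range τ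
      · obtain ⟨n, rfl⟩ := hr
        exact ⟨n, by rw [Set.mem_ofPred_eq, hτ] at hm; exact hm, rfl⟩
      · exact absurd (hT hm) (hout m hr)
    · rintro ⟨n, hn, rfl⟩
      rw [Set.mem_ofPred_eq, hτ]
      exact hn
  rw [this, Set.infinite_image_iff hmono.injective.injOn]

/-- If no return to `S` follows the last one listed by `V`, there are only finitely many visits. -/
theorem finite_visits {V : ℕ → C} {N : ℕ}
    (hV : ∀ n < N, ReachesAvoiding step S (step (V n)) (V (n + 1)))
    (hN : ∀ m, step^[m] (step (V N)) ∉ S) :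
    {m | step^[m] (V 0) ∈ S}.Finite := by
  have key : ∀ n ≤ N, ∃ t, step^[t] (V 0) = V n := by
    intro n
    induction n with
    | zero => exact fun _ => ⟨0, rfl⟩
    | succ n ih =>
      intro hn
      obtain ⟨t, ht⟩ := ih (by omega)
      obtain ⟨d, hd, -⟩ := (hV n (by omega)).exists_iterate
      exact ⟨d + 1 + t, by rw [Function.iterate_add_apply, ht, Function.iterate_succ_apply, hd]⟩
  obtain ⟨t, ht⟩ := key N le_rfl
  refine (Set.finite_Iic t).subset fun m hm => ?_
  by_contra hcon
  have hlt : t < m := not_le.1 hcon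
  have h1 : m = (m - t - 1) + 1 + t := by omega
  rw [Set.mem_ofPred_eq, h1, Function.iterate_add_apply, ht, Function.iterate_succ_apply] at hm
  exact hN _ hm

end ReachesAvoiding

/-! ### The block machine -/

/-- The data of a two-morphism prefix problem over the alphabet `Y`: two morphisms, the repeated
letter and the fixed part of the initial word, and the letter that has to be reached. -/
structure TileSystem (Y : Type) where
  /-- the words consumed by the tiles -/
  consume : Y → List Y
  /-- the words produced by the tiles -/
  produce : Y → List Y
  /-- the letter `c` of the initial word `cⁿ pre` -/
  unit : Y
  /-- the word `pre` of the initial word `cⁿ pre` -/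
  pre : List Y
  /-- the letter marking success -/
  tick : Y

namespace TileSystem

variable {Y : Type} (P : TileSystem Y) (n : ℕ)

/-- The morphism of the first test (`false`) and of the second test (`true`). -/
def morphism : Bool → Y → List Y
  | false => P.produce
  | true => P.consume

/-- The word that each test puts after the image of the tile sequence. -/
def ending : Bool → List Y
  | false => []
  | true => [P.tick]

/-- The word that each test puts before the image of the tile sequence. -/
def front : Bool → List Y
  | false => List.replicate n P.unit ++ P.pre
  | true => []

/-- The two tests on a pair of finite words. -/
def Test (i : Bool) (y z : List Y) : Prop :=
  P.front n i ++ (y.flatMap (P.morphism i) ++ P.ending i) <+: z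

/-- Some pair of finite words passes both tests. -/
def Solvable : Prop :=
  ∃ y z : List Y, ∀ i, P.Test n i y z

end TileSystem

/-- States of the block machine. -/
inductive BlockState (k : ℕ) (Y : Type) : Type
  /-- beginning of a block, which is going to be subjected to the test `i` -/
  | start (i : Bool)
  /-- in the first test, `m` copies of the repeated letter are still expected on tape `1` -/
  | chain (m : ℕ)
  /-- in the test `i`, the word `l` is expected on tape `1`; `fin` tells whether the block of tape
  `0` has been read completely -/
  | expect (i fin : Bool) (l : List Y)
  /-- the test has been decided; `y` and `z` tell whether the blocks of the tapes `0` and `1` are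
  still to be read to the end, and the test `r` is the one to be applied to the next block -/
  | skip (y z r : Bool)
  /-- one more letter is read on each tape from `j` on, then the test `r` is applied -/
  | pad (j : Fin k) (r : Bool)

namespace BlockState

variable {κ : ℕ} {Y : Type}

/-- The tape on which a state of the block machine reads. -/
def comp : BlockState (κ + 2) Y → Fin (κ + 2)
  | expect _ false [] => 0
  | skip true _ _ => 0
  | pad j _ => j
  | _ => 1

variable (P : TileSystem Y) (n : ℕ)

/-- The silent moves of the block machine. -/
def silent : BlockState (κ + 2) Y → Option (BlockState (κ + 2) Y)
  | start false => some (chain n)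
  | start true => some (expect true false [])
  | chain 0 => some (expect false false P.pre)
  | expect i true [] => some (skip false true i)
  | skip false false r => some (pad 0 r)
  | _ => none

/-- The reading moves of the block machine; the letter `none` ends the blocks. On success of the test
`i` the next block gets the same test, on failure it gets the other one. -/
def onLetter [DecidableEq Y] : BlockState (κ + 2) Y → Option Y → BlockState (κ + 2) Y
  | chain (m + 1), x => if x = some P.unit then chain m else skip true x.isSome true
  | expect i fin (b :: l), x =>
    if x = some b then expect i fin l else skip (!fin) x.isSome (!i)
  | expect i _ [], none => expect i true (P.ending i)
  | expect i _ [], some t => expect i false (P.morphism i t)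
  | skip true z r, x => skip x.isSome z r
  | skip false _ r, none => pad 0 r
  | skip false _ r, some _ => skip false true r
  | pad j r, _ => if h : (j : ℕ) + 1 < κ + 2 then pad ⟨j + 1, h⟩ r else start r
  | q, _ => q

end BlockState

/-- The block machine of a tile system: on tapes whose first two components are divided into blocks
by the letter `none`, it applies one of the two tests to each block. -/
def blockMachine {Y : Type} [DecidableEq Y] (κ : ℕ) (P : TileSystem Y) (n : ℕ) :
    ReadMachine (κ + 2) (Option Y) (BlockState (κ + 2) Y) where
  comp := BlockState.comp
  eps := BlockState.silent P n
  read := BlockState.onLetter P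

/-- The infinite word `w` has the block `l` at position `p`: the letters of `l`, then `none`. -/
def HasBlock {Y : Type} (w : ℕ → Option Y) : ℕ → List Y → Prop
  | p, [] => w p = none
  | p, y :: l => w p = some y ∧ HasBlock w (p + 1) l

theorem HasBlock.unique {Y : Type} {w : ℕ → Option Y} {p : ℕ} {l l' : List Y}
    (h : HasBlock w p l) (h' : HasBlock w p l') : l = l' := by
  induction l generalizing p l' with
  | nil =>
    cases l' with
    | nil => rfl
    | cons y l' => simp [HasBlock] at h h'; simp [h] at h'
  | cons x l ih =>
    cases l' with
    | nil => simp [HasBlock] at h h'; simp [h] at h'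
    | cons y l' =>
      obtain ⟨h1, h2⟩ := h
      obtain ⟨h1', h2'⟩ := h'
      rw [ih h2 h2', Option.some_injective _ (h1.symm.trans h1')]

theorem exists_hasBlock {Y : Type} {w : ℕ → Option Y} {p i : ℕ} (h : w (p + i) = none) :
    ∃ l, HasBlock w p l := by
  induction i generalizing p with
  | zero => exact ⟨[], h⟩
  | succ i ih =>
    cases hw : w p with
    | none => exact ⟨[], hw⟩
    | some y =>
      obtain ⟨l, hl⟩ := ih (p := p + 1) (by rw [← h]; congr 1; omega)
      exact ⟨y :: l, hw, hl⟩

namespace BlockMachine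

variable {κ : ℕ} {Y : Type} [DecidableEq Y] (P : TileSystem Y) (n : ℕ)
  (u : Fin (κ + 2) → ℕ → Option Y)

open BlockState

/-- The configurations at the beginning of a block. -/
def starts : Set (BlockState (κ + 2) Y × (Fin (κ + 2) → ℕ)) :=
  {c | ∃ i, c.1 = start i}

/-- Reachability of configurations of the block machine inside of a block. -/
abbrev Go (c c' : BlockState (κ + 2) Y × (Fin (κ + 2) → ℕ)) : Prop :=
  ReachesAvoiding ((blockMachine κ P n).step u) starts c c'

/-- Head positions with `a` on tape `0` and `b` on tape `1`, given by `pos` elsewhere. -/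
def setPos (pos : Fin (κ + 2) → ℕ) (a b : ℕ) : Fin (κ + 2) → ℕ :=
  fun j => if j = 0 then a else if j = 1 then b else pos j

variable {P n u} {pos : Fin (κ + 2) → ℕ}

@[simp]
theorem setPos_zero (a b : ℕ) : setPos pos a b 0 = a := rfl

@[simp]
theorem setPos_one (a b : ℕ) : setPos pos a b 1 = b := rfl

theorem step_eps {q q' : BlockState (κ + 2) Y} {p : Fin (κ + 2) → ℕ} (h : silent P n q = some q') :
    (blockMachine κ P n).step u (q, p) = (q', p) := by
  simp [ReadMachine.step, blockMachine, h]

theorem step_read_zero {q : BlockState (κ + 2) Y} {a b : ℕ} (h : silent P n q = none)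
    (hc : q.comp = 0) :
    (blockMachine κ P n).step u (q, setPos pos a b) =
      (onLetter P q (u 0 a), setPos pos (a + 1) b) := by
  simp only [ReadMachine.step, blockMachine, h, hc, setPos_zero, Prod.mk.injEq, true_and]
  funext j
  by_cases hj : j = 0 <;> simp [setPos, hj]

theorem step_read_one {q : BlockState (κ + 2) Y} {a b : ℕ} (h : silent P n q = none)
    (hc : q.comp = 1) :
    (blockMachine κ P n).step u (q, setPos pos a b) =
      (onLetter P q (u 1 b), setPos pos a (b + 1)) := by
  simp only [ReadMachine.step, blockMachine, h, hc, setPos_one, Prod.mk.injEq, true_and]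
  funext j
  by_cases hj : j = 0
  · subst hj
    simp [setPos]
  · by_cases hj1 : j = 1 <;> simp [setPos, hj, hj1]

theorem Go.of_step {c c' d : BlockState (κ + 2) Y × (Fin (κ + 2) → ℕ)}
    (h : (blockMachine κ P n).step u c = c') (hc : ∀ i, c.1 ≠ start i) (hd : Go P n u c' d) :
    Go P n u c d :=
  .head (fun ⟨i, hi⟩ => hc i hi) (h ▸ hd)

theorem add_length_cons_add_one (a : ℕ) (x : Y) (l : List Y) :
    a + (x :: l).length + 1 = a + 1 + l.length + 1 := by
  rw [List.length_cons]
  omega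

theorem go_skip_false {a b : ℕ} {z : List Y} {r : Bool} (hz : HasBlock (u 1) b z) :
    Go P n u (skip false true r, setPos pos a b)
      (pad 0 r, setPos pos a (b + z.length + 1)) := by
  induction z generalizing b with
  | nil =>
    refine Go.of_step (step_read_one rfl rfl) (by simp) ?_
    rw [show u 1 b = none from hz]
    exact .refl _
  | cons x z ih =>
    refine Go.of_step (step_read_one rfl rfl) (by simp) ?_
    rw [hz.1, add_length_cons_add_one]
    exact ih hz.2

theorem go_skip_true {a b : ℕ} {y : List Y} {zz r : Bool} (hy : HasBlock (u 0) a y) :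
    Go P n u (skip true zz r, setPos pos a b)
      (skip false zz r, setPos pos (a + y.length + 1) b) := by
  induction y generalizing a with
  | nil =>
    refine Go.of_step (step_read_zero rfl rfl) (by simp) ?_
    rw [show u 0 a = none from hy]
    exact .refl _
  | cons x y ih =>
    refine Go.of_step (step_read_zero rfl rfl) (by simp) ?_
    rw [hy.1, add_length_cons_add_one]
    exact ih hy.2

/-- After a mismatch on tape `1` in the final phase of a test. -/
theorem go_mismatch_fin {a b : ℕ} {z : List Y} {r : Bool} (hz : HasBlock (u 1) b z) :
    Go P n u (skip false (u 1 b).isSome r, setPos pos a (b + 1))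
      (pad 0 r, setPos pos a (b + z.length + 1)) := by
  cases z with
  | nil =>
    rw [show u 1 b = none from hz]
    exact Go.of_step (step_eps rfl) (by simp) (.refl _)
  | cons x z =>
    rw [hz.1, add_length_cons_add_one]
    exact go_skip_false hz.2

/-- After a mismatch on tape `1` in an earlier phase of a test. -/
theorem go_mismatch {a b : ℕ} {y z : List Y} {r : Bool} (hy : HasBlock (u 0) a y)
    (hz : HasBlock (u 1) b z) :
    Go P n u (skip true (u 1 b).isSome r, setPos pos a (b + 1))
      (pad 0 r, setPos pos (a + y.length + 1) (b + z.length + 1)) :=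
  (go_skip_true hy).trans (go_mismatch_fin hz)

theorem _root_.Bool.eq_not_of_iff_false {r i : Bool} {p : Prop} (h : r = i ↔ p) (hp : ¬ p) :
    r = !i := by
  cases r <;> cases i <;> simp_all

theorem cons_prefix_iff_of_hasBlock {w : ℕ → Option Y} {p : ℕ} {b : Y} {l z : List Y}
    (hz : HasBlock w p z) :
    b :: l <+: z ↔ w p = some b ∧ ∃ z', z = b :: z' ∧ l <+: z' := by
  cases z with
  | nil => simp
  | cons x z =>
    rw [List.cons_prefix_cons, hz.1]
    constructor
    · rintro ⟨rfl, h⟩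
      exact ⟨rfl, z, rfl, h⟩
    · rintro ⟨-, z', h, h'⟩
      simp only [List.cons.injEq] at h
      exact ⟨h.1.symm, h.2 ▸ h'⟩

theorem go_expect_fin {i r : Bool} {l : List Y} {a b : ℕ} {z : List Y}
    (hz : HasBlock (u 1) b z) (hr : r = i ↔ l <+: z) :
    Go P n u (expect i true l, setPos pos a b) (pad 0 r, setPos pos a (b + z.length + 1)) := by
  induction l generalizing b z with
  | nil =>
    obtain rfl : r = i := hr.2 List.nil_prefix
    exact Go.of_step (step_eps rfl) (by simp) (go_skip_false hz)
  | cons x l ih =>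
    refine Go.of_step (step_read_one rfl rfl) (by simp) ?_
    rw [cons_prefix_iff_of_hasBlock hz] at hr
    by_cases hx : u 1 b = some x
    · cases z with
      | nil => simp [HasBlock, hx] at hz
      | cons x' z =>
        obtain rfl : x = x' := Option.some_injective _ (hx.symm.trans hz.1)
        simp only [onLetter, hx, if_true, add_length_cons_add_one b]
        exact ih hz.2 (by simpa [hx] using hr)
    · obtain rfl : r = !i := Bool.eq_not_of_iff_false hr (fun h => hx h.1)
      simp only [onLetter, hx, if_false]
      exact go_mismatch_fin hz

theorem go_expect {i r : Bool} {l : List Y} {a b : ℕ} {y z : List Y}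
    (hy : HasBlock (u 0) a y) (hz : HasBlock (u 1) b z)
    (hr : r = i ↔ l ++ (y.flatMap (P.morphism i) ++ P.ending i) <+: z) :
    Go P n u (expect i false l, setPos pos a b)
      (pad 0 r, setPos pos (a + y.length + 1) (b + z.length + 1)) := by
  induction y generalizing a b l z with
  | nil =>
    induction l generalizing b z with
    | nil =>
      refine Go.of_step (step_read_zero rfl rfl) (by simp) ?_
      rw [show u 0 a = none from hy]
      exact go_expect_fin hz hr
    | cons x l ih =>
      refine Go.of_step (step_read_one rfl rfl) (by simp) ?_
      rw [List.cons_append, cons_prefix_iff_of_hasBlock hz] at hr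
      by_cases hx : u 1 b = some x
      · cases z with
        | nil => simp [HasBlock, hx] at hz
        | cons x' z =>
          obtain rfl : x = x' := Option.some_injective _ (hx.symm.trans hz.1)
          simp only [onLetter, hx, if_true, add_length_cons_add_one b]
          exact ih hz.2 (by simpa [hx] using hr)
      · obtain rfl : r = !i := Bool.eq_not_of_iff_false hr (fun h => hx h.1)
        simp only [onLetter, hx, if_false]
        exact go_mismatch hy hz
  | cons t y ihy =>
    induction l generalizing b z with
    | nil =>
      refine Go.of_step (step_read_zero rfl rfl) (by simp) ?_
      rw [hy.1, add_length_cons_add_one a]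
      exact ihy hy.2 hz (by simpa using hr)
    | cons x l ih =>
      refine Go.of_step (step_read_one rfl rfl) (by simp) ?_
      rw [List.cons_append, cons_prefix_iff_of_hasBlock hz] at hr
      by_cases hx : u 1 b = some x
      · cases z with
        | nil => simp [HasBlock, hx] at hz
        | cons x' z =>
          obtain rfl : x = x' := Option.some_injective _ (hx.symm.trans hz.1)
          simp only [onLetter, hx, if_true, add_length_cons_add_one b]
          exact ih hz.2 (by simpa [hx] using hr)
      · obtain rfl : r = !i := Bool.eq_not_of_iff_false hr (fun h => hx h.1)
        simp only [onLetter, hx, if_false]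
        exact go_mismatch hy hz

theorem go_chain {m : ℕ} {r : Bool} {a b : ℕ} {y z : List Y}
    (hy : HasBlock (u 0) a y) (hz : HasBlock (u 1) b z)
    (hr : r = false ↔ (List.replicate m P.unit ++ P.pre) ++
      (y.flatMap (P.morphism false) ++ P.ending false) <+: z) :
    Go P n u (chain m, setPos pos a b)
      (pad 0 r, setPos pos (a + y.length + 1) (b + z.length + 1)) := by
  induction m generalizing b z with
  | zero =>
    refine Go.of_step (step_eps rfl) (by simp) (go_expect hy hz ?_)
    simpa using hr
  | succ m ih =>
    refine Go.of_step (step_read_one rfl rfl) (by simp) ?_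
    rw [List.replicate_succ, List.cons_append, List.cons_append,
      cons_prefix_iff_of_hasBlock hz] at hr
    by_cases hx : u 1 b = some P.unit
    · cases z with
      | nil => simp [HasBlock, hx] at hz
      | cons x' z =>
        obtain rfl : P.unit = x' := Option.some_injective _ (hx.symm.trans hz.1)
        simp only [onLetter, hx, if_true, add_length_cons_add_one b]
        exact ih hz.2 (by simpa [hx] using hr)
    · obtain rfl : r = true := by
        cases r with
        | true => rfl
        | false => exact absurd (hr.1 rfl).1 hx
      simp only [onLetter, hx, if_false]
      exact go_mismatch hy hz

theorem go_pad {m : ℕ} {j : Fin (κ + 2)} {r : Bool} {p : Fin (κ + 2) → ℕ}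
    (hm : (j : ℕ) + m = κ + 1) :
    Go P n u (pad j r, p) (start r, fun l => if j ≤ l then p l + 1 else p l) := by
  induction m generalizing j p with
  | zero =>
    refine Go.of_step rfl (by simp) ?_
    have hj : ¬ (j : ℕ) + 1 < κ + 2 := by omega
    simp only [ReadMachine.step, blockMachine, silent, onLetter, comp, dif_neg hj]
    have hpos : (fun l => if j ≤ l then p l + 1 else p l) =
        fun l => if l = j then p l + 1 else p l := by
      funext l
      have : j ≤ l ↔ l = j := by
        rw [Fin.le_def, Fin.ext_iff]
        omega
      simp [this]
    rw [hpos]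
    exact .refl _
  | succ m ih =>
    refine Go.of_step rfl (by simp) ?_
    have hj : (j : ℕ) + 1 < κ + 2 := by omega
    simp only [ReadMachine.step, blockMachine, silent, onLetter, comp, dif_pos hj]
    have hgo := ih (j := ⟨j + 1, hj⟩) (p := fun l => if l = j then p l + 1 else p l)
      (by simp only; omega)
    have hpos : (fun l => if j ≤ l then p l + 1 else p l) = fun l =>
        if (⟨j + 1, hj⟩ : Fin (κ + 2)) ≤ l then (if l = j then p l + 1 else p l) + 1
        else if l = j then p l + 1 else p l := by
      funext l
      by_cases h1 : l = j
      · subst h1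
        simp [Fin.le_def]
      · have : j ≤ l ↔ (⟨j + 1, hj⟩ : Fin (κ + 2)) ≤ l := by
          rw [Fin.le_def, Fin.le_def]
          rw [Fin.ext_iff] at h1
          simp only
          omega
        simp [h1, this]
    rw [hpos]
    exact hgo

/-- The head positions after a block `y`, `z`. -/
def afterBlock (pos : Fin (κ + 2) → ℕ) (y z : List Y) : Fin (κ + 2) → ℕ :=
  fun j => setPos pos (pos 0 + y.length + 1) (pos 1 + z.length + 1) j + 1

/-- On a complete block, the machine performs the test and returns to a starting state. -/
theorem go_block {i r : Bool} {y z : List Y} (hy : HasBlock (u 0) (pos 0) y)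
    (hz : HasBlock (u 1) (pos 1) z) (hr : r = i ↔ P.Test n i y z) :
    Go P n u ((blockMachine κ P n).step u (start i, pos)) (start r, afterBlock pos y z) := by
  have hpos : pos = setPos pos (pos 0) (pos 1) := by
    funext j
    simp only [setPos]
    split_ifs with h0 h1
    · rw [h0]
    · rw [h1]
    · rfl
  have hpad : Go P n u (pad 0 r, setPos pos (pos 0 + y.length + 1) (pos 1 + z.length + 1))
      (start r, afterBlock pos y z) := by
    have := go_pad (P := P) (n := n) (u := u) (m := κ + 1) (j := 0) (r := r)
      (p := setPos pos (pos 0 + y.length + 1) (pos 1 + z.length + 1)) (by simp)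
    simp only [Fin.zero_le, if_true] at this
    exact this
  have hgo : Go P n u ((blockMachine κ P n).step u (start i, pos))
      (pad 0 r, setPos pos (pos 0 + y.length + 1) (pos 1 + z.length + 1)) := by
    conv in (start i, pos) => rw [hpos]
    cases i with
    | false =>
      rw [step_eps rfl]
      exact go_chain hy hz hr
    | true =>
      rw [step_eps rfl]
      exact go_expect hy hz hr
  exact hgo.trans hpad

/-- If one of the first two tapes has no end of a block any more, the machine never returns to a
starting state. -/
theorem never_starts {i : Bool}
    (h : (∀ a, pos 0 ≤ a → u 0 a ≠ none) ∨ (∀ b, pos 1 ≤ b → u 1 b ≠ none)) (m : ℕ) :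
    ((blockMachine κ P n).step u)^[m] ((blockMachine κ P n).step u (start i, pos)) ∉ starts := by
  rcases h with h | h
  · -- the machine stays in the phases in which the block of tape `0` is not finished
    let Inv : BlockState (κ + 2) Y × (Fin (κ + 2) → ℕ) → Prop := fun c =>
      (∀ a, c.2 0 ≤ a → u 0 a ≠ none) ∧
        match c.1 with
        | chain _ => True
        | expect _ false _ => True
        | skip true _ _ => True
        | _ => False
    have hstep : ∀ c, Inv c → Inv ((blockMachine κ P n).step u c) := by
      rintro ⟨q, p⟩ ⟨h1, h2⟩
      have h0 : ∃ x, u 0 (p 0) = some x := Option.ne_none_iff_exists'.1 (h1 _ le_rfl)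
      obtain ⟨x, hx⟩ := h0
      refine ⟨fun a ha => h1 a (le_trans ?_ ha), ?_⟩
      · simp only [ReadMachine.step]
        split
        · exact le_rfl
        · simp only
          split <;> omega
      · rcases q with i | (_ | m) | ⟨i, _ | _, _ | ⟨b, l⟩⟩ | ⟨_ | _, z, r⟩ | ⟨j, r⟩ <;>
          simp only [] at h2 <;>
          simp only [ReadMachine.step, blockMachine, silent, onLetter, comp, hx] <;>
          first | trivial | (split_ifs <;> trivial)
    have hinit : Inv ((blockMachine κ P n).step u (start i, pos)) := by
      cases i <;> exact ⟨h, trivial⟩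
    have hall : ∀ m, Inv (((blockMachine κ P n).step u)^[m]
        ((blockMachine κ P n).step u (start i, pos))) := by
      intro m
      induction m with
      | zero => exact hinit
      | succ m ih => rw [Function.iterate_succ_apply']; exact hstep _ ih
    rintro ⟨i', hi'⟩
    have := (hall m).2
    rw [hi'] at this
    exact this
  · -- the machine stays in the phases in which the block of tape `1` is not finished
    let Inv : BlockState (κ + 2) Y × (Fin (κ + 2) → ℕ) → Prop := fun c =>
      (∀ a, c.2 1 ≤ a → u 1 a ≠ none) ∧
        match c.1 with
        | chain _ => True
        | expect _ _ _ => True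
        | skip _ true _ => True
        | _ => False
    have hstep : ∀ c, Inv c → Inv ((blockMachine κ P n).step u c) := by
      rintro ⟨q, p⟩ ⟨h1, h2⟩
      have h0 : ∃ x, u 1 (p 1) = some x := Option.ne_none_iff_exists'.1 (h1 _ le_rfl)
      obtain ⟨x, hx⟩ := h0
      refine ⟨fun a ha => h1 a (le_trans ?_ ha), ?_⟩
      · simp only [ReadMachine.step]
        split
        · exact le_rfl
        · simp only
          split <;> omega
      · rcases q with i | (_ | m) | ⟨i, _ | _, _ | ⟨b, l⟩⟩ | ⟨_ | _, _ | _, r⟩ | ⟨j, r⟩ <;>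
          simp only [] at h2 <;>
          simp only [ReadMachine.step, blockMachine, silent, onLetter, comp, hx] <;>
          first | trivial | (cases u 0 (p 0) <;> trivial) | (split_ifs <;> trivial)
    have hinit : Inv ((blockMachine κ P n).step u (start i, pos)) := by
      cases i <;> exact ⟨h, trivial⟩
    have hall : ∀ m, Inv (((blockMachine κ P n).step u)^[m]
        ((blockMachine κ P n).step u (start i, pos))) := by
      intro m
      induction m with
      | zero => exact hinit
      | succ m ih => rw [Function.iterate_succ_apply']; exact hstep _ ih
    rintro ⟨i', hi'⟩
    have := (hall m).2
    rw [hi'] at this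
    exact this

end BlockMachine

/-! ### Acceptance by the block machine -/

namespace BlockMachine

variable {κ : ℕ} {Y : Type} [DecidableEq Y] (P : TileSystem Y) (n : ℕ)
  (u : Fin (κ + 2) → ℕ → Option Y)

open BlockState

/-- The block machine, started with the test `i`, reads the tapes `u` completely and begins infinitely
often a block with the second test. -/
def Accepts (i : Bool) : Prop :=
  (∀ j N, ∃ m, N ≤ ((blockMachine κ P n).run u (start i) m).2 j) ∧
    {m | ((blockMachine κ P n).run u (start i) m).1 = start true}.Infinite

open Classical in
/-- The block of `w` at position `p`, if there is one. -/
noncomputable def blockAt (w : ℕ → Option Y) (p : ℕ) : List Y :=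
  if h : ∃ l, HasBlock w p l then h.choose else []

variable {w : ℕ → Option Y} in
theorem hasBlock_blockAt {p : ℕ} (h : ∃ l, HasBlock w p l) : HasBlock w p (blockAt w p) := by
  rw [blockAt, dif_pos h]
  exact h.choose_spec

variable {w : ℕ → Option Y} in
theorem _root_.HasBlock.blockAt_eq {p : ℕ} {l : List Y} (h : HasBlock w p l) : blockAt w p = l :=
  (hasBlock_blockAt ⟨l, h⟩).unique h

/-- The head positions at the beginning of the `m`-th block. -/
noncomputable def posSeq : ℕ → Fin (κ + 2) → ℕ
  | 0 => fun _ => 0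
  | m + 1 => afterBlock (posSeq m) (blockAt (u 0) (posSeq m 0)) (blockAt (u 1) (posSeq m 1))

open Classical in
/-- The test applied to the `m`-th block, when the first block gets the test `i`. -/
noncomputable def testSeq (i : Bool) : ℕ → Bool
  | 0 => i
  | m + 1 =>
    if P.Test n (testSeq i m) (blockAt (u 0) (posSeq u m 0)) (blockAt (u 1) (posSeq u m 1)) then
      testSeq i m
    else !testSeq i m

/-- The first two tapes consist of infinitely many complete blocks. -/
def Complete : Prop :=
  ∀ m, (∃ l, HasBlock (u 0) (posSeq u m 0) l) ∧ ∃ l, HasBlock (u 1) (posSeq u m 1) l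

variable {P n u}

theorem le_posSeq (m : ℕ) (j : Fin (κ + 2)) : m ≤ posSeq u m j := by
  induction m with
  | zero => exact Nat.zero_le _
  | succ m ih =>
    rw [posSeq, afterBlock, setPos]
    have h0 := ih
    refine Nat.succ_le_succ (h0.trans ?_)
    split_ifs with h h'
    · subst h
      omega
    · subst h'
      omega
    · exact le_rfl

theorem go_posSeq (i : Bool) {m : ℕ}
    (h : (∃ l, HasBlock (u 0) (posSeq u m 0) l) ∧ ∃ l, HasBlock (u 1) (posSeq u m 1) l) :
    Go P n u ((blockMachine κ P n).step u (start (testSeq P n u i m), posSeq u m))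
      (start (testSeq P n u i (m + 1)), posSeq u (m + 1)) := by
  refine go_block (hasBlock_blockAt h.1) (hasBlock_blockAt h.2) ?_
  rw [testSeq]
  split_ifs with ht
  · simpa using ht
  · simpa using ht

/-- Acceptance depends only on the sequence of tests at the beginnings of the blocks. -/
theorem accepts_iff (i : Bool) :
    Accepts P n u i ↔ Complete u ∧ {m | testSeq P n u i m = true}.Infinite := by
  let V : ℕ → BlockState (κ + 2) Y × (Fin (κ + 2) → ℕ) :=
    fun m => (start (testSeq P n u i m), posSeq u m)
  by_cases hc : Complete u
  · have hV : ∀ m, Go P n u ((blockMachine κ P n).step u (V m)) (V (m + 1)) :=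
      fun m => go_posSeq i (hc m)
    have hvis := ReachesAvoiding.infinite_visits_iff hV
      (T := {c | c.1 = start true}) (fun c hc => ⟨true, hc⟩)
    have hV2 : {m | V m ∈ {c : BlockState (κ + 2) Y × (Fin (κ + 2) → ℕ) | c.1 = start true}} =
        {m | testSeq P n u i m = true} := by
      ext m
      change start _ = start true ↔ testSeq P n u i m = true
      rw [start.injEq]
    rw [hV2] at hvis
    refine ⟨fun h => ⟨hc, hvis.1 h.2⟩, fun h => ⟨fun j N => ?_, hvis.2 h.2⟩⟩
    obtain ⟨τ, -, hτ, -⟩ := ReachesAvoiding.exists_strictMono_times hV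
    refine ⟨τ N, ?_⟩
    have : (blockMachine κ P n).run u (start i) (τ N) = V N := hτ N
    rw [this]
    exact le_posSeq N j
  · refine ⟨fun h => absurd h.2 (Set.not_infinite.2 ?_), fun h => absurd h.1 hc⟩
    -- the first incomplete block is never left
    have hex : ∃ m, ¬ ((∃ l, HasBlock (u 0) (posSeq u m 0) l) ∧
        ∃ l, HasBlock (u 1) (posSeq u m 1) l) := not_forall.1 hc
    obtain ⟨N, hN, hmin⟩ : ∃ N, ¬ ((∃ l, HasBlock (u 0) (posSeq u N 0) l) ∧
        ∃ l, HasBlock (u 1) (posSeq u N 1) l) ∧ ∀ m < N,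
        (∃ l, HasBlock (u 0) (posSeq u m 0) l) ∧ ∃ l, HasBlock (u 1) (posSeq u m 1) l := by
      classical
      exact ⟨Nat.find hex, Nat.find_spec hex, fun m hm => not_not.1 (Nat.find_min hex hm)⟩
    have hfin := ReachesAvoiding.finite_visits (V := V) (N := N)
      (step := (blockMachine κ P n).step u) (S := starts) (fun m hm => go_posSeq i (hmin m hm)) (by
        refine never_starts ?_
        by_contra hcon
        push Not at hcon
        obtain ⟨⟨a, ha, ha'⟩, b, hb, hb'⟩ := hcon
        refine hN ⟨exists_hasBlock (i := a - posSeq u N 0) ?_,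
          exists_hasBlock (i := b - posSeq u N 1) ?_⟩
        · rwa [Nat.add_sub_cancel' ha]
        · rwa [Nat.add_sub_cancel' hb])
    exact hfin.subset fun m hm => ⟨true, hm⟩

/-- If no pair of words passes both tests, then in every block either the two runs get synchronized,
or both tests fail and both runs change their test, so that each test is applied infinitely often. -/
theorem accepts_false_iff_accepts_true (h : ¬ P.Solvable n) :
    Accepts P n u false ↔ Accepts P n u true := by
  rw [accepts_iff, accepts_iff]
  refine and_congr_right fun _ => ?_
  by_cases hs : ∃ m, testSeq P n u false m = testSeq P n u true m
  · obtain ⟨m, hm⟩ := hs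
    have hall : ∀ d, testSeq P n u false (m + d) = testSeq P n u true (m + d) := by
      intro d
      induction d with
      | zero => exact hm
      | succ d ih => rw [← Nat.add_assoc, testSeq, testSeq, ih]
    rw [← Nat.frequently_atTop_iff_infinite, ← Nat.frequently_atTop_iff_infinite]
    refine Filter.frequently_congr (Filter.eventually_atTop.2 ⟨m, fun l hl => ?_⟩)
    obtain ⟨d, rfl⟩ := Nat.exists_eq_add_of_le hl
    rw [hall]
  · push Not at hs
    have hflip : ∀ i m, testSeq P n u i (m + 1) = !testSeq P n u i m := by
      intro i m
      have hne := hs m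
      have hne' := hs (m + 1)
      have hno : ¬ (P.Test n false (blockAt (u 0) (posSeq u m 0)) (blockAt (u 1) (posSeq u m 1)) ∧
          P.Test n true (blockAt (u 0) (posSeq u m 0)) (blockAt (u 1) (posSeq u m 1))) :=
        fun ht => h ⟨_, _, fun i => by cases i; exacts [ht.1, ht.2]⟩
      rw [testSeq, testSeq] at hne'
      cases h1 : testSeq P n u false m <;> cases h2 : testSeq P n u true m <;>
        rw [h1, h2] at hne'
      · exact absurd (h1.trans h2.symm) hne
      · cases i <;> rw [testSeq] <;> split_ifs at hne' ⊢ <;> simp_all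
      · cases i <;> rw [testSeq] <;> split_ifs at hne' ⊢ <;> simp_all
      · exact absurd (h1.trans h2.symm) hne
    have hinf : ∀ i, {m | testSeq P n u i m = true}.Infinite := by
      intro i
      refine Set.infinite_of_not_bddAbove fun ⟨N, hN⟩ => ?_
      have h1 : ¬ testSeq P n u i (N + 1) = true := fun ht => by
        have := hN ht
        omega
      have h2 : ¬ testSeq P n u i (N + 2) = true := fun ht => by
        have := hN ht
        omega
      rw [hflip i (N + 1)] at h2
      simp at h1 h2
      simp [h1] at h2
    exact iff_of_true (hinf false) (hinf true)

/-- The infinite word `l none none l none none …`; the first `none` ends the block `l`, the second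
one is the padding letter after it. -/
def periodicBlocks (l : List Y) : ℕ → Option Y :=
  fun m => (l.map some)[m % (l.length + 2)]?.join

theorem hasBlock_periodicBlocks (l : List Y) (m : ℕ) :
    HasBlock (periodicBlocks l) (m * (l.length + 2)) l := by
  have key : ∀ (l' : List Y) (d : ℕ), l.drop d = l' → d ≤ l.length →
      HasBlock (periodicBlocks l) (m * (l.length + 2) + d) l' := by
    intro l'
    induction l' with
    | nil =>
      intro d hd hle
      have : l.length ≤ d := List.drop_eq_nil_iff.1 hd
      change periodicBlocks l _ = none
      rw [periodicBlocks, Nat.mul_add_mod_of_lt (by omega)]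
      rw [List.getElem?_eq_none (by simpa using this)]
      rfl
    | cons y l' ih =>
      intro d hd hle
      have hlt : d < l.length := by
        by_contra hcon
        rw [List.drop_eq_nil_of_le (not_lt.1 hcon)] at hd
        simp at hd
      rw [List.drop_eq_getElem_cons hlt, List.cons.injEq] at hd
      refine ⟨?_, ih (d + 1) hd.2 (by omega)⟩
      rw [periodicBlocks, Nat.mul_add_mod_of_lt (by omega)]
      simp [List.getElem?_eq_getElem hlt, hd.1]
  exact key l 0 rfl (Nat.zero_le _)

/-- If some pair of words passes both tests, then on the periodic repetition of this block each run
keeps its test for ever. -/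
theorem exists_accepts_true_not_accepts_false (h : P.Solvable n) :
    ∃ u : Fin (κ + 2) → ℕ → Option Y, Accepts P n u true ∧ ¬ Accepts P n u false := by
  obtain ⟨y, z, ht⟩ := h
  let u : Fin (κ + 2) → ℕ → Option Y := fun j => if j = 0 then periodicBlocks y else periodicBlocks z
  have hu0 : u 0 = periodicBlocks y := rfl
  have hu1 : u 1 = periodicBlocks z := rfl
  have hpos : ∀ m, posSeq u m 0 = m * (y.length + 2) ∧ posSeq u m 1 = m * (z.length + 2) := by
    intro m
    induction m with
    | zero => simp [posSeq]
    | succ m ih =>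
      rw [posSeq, ih.1, ih.2, hu0, hu1, (hasBlock_periodicBlocks y m).blockAt_eq,
        (hasBlock_periodicBlocks z m).blockAt_eq, afterBlock, afterBlock, setPos_zero, setPos_one,
        ih.1, ih.2]
      constructor <;> ring
  have hy : ∀ m, HasBlock (u 0) (posSeq u m 0) y := fun m => by
    rw [(hpos m).1]; exact hasBlock_periodicBlocks y m
  have hz : ∀ m, HasBlock (u 1) (posSeq u m 1) z := fun m => by
    rw [(hpos m).2]; exact hasBlock_periodicBlocks z m
  have hconst : ∀ i m, testSeq P n u i m = i := by
    intro i m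
    induction m with
    | zero => rfl
    | succ m ih => rw [testSeq, ih, (hy m).blockAt_eq, (hz m).blockAt_eq, if_pos (ht i)]
  refine ⟨u, (accepts_iff true).2 ⟨fun m => ⟨⟨y, hy m⟩, ⟨z, hz m⟩⟩, ?_⟩, fun hacc => ?_⟩
  · simp only [hconst]
    simpa using Set.infinite_univ
  · have := ((accepts_iff false).1 hacc).2
    simp [hconst] at this

theorem forall_accepts_iff :
    (∀ u : Fin (κ + 2) → ℕ → Option Y, Accepts P n u false ↔ Accepts P n u true) ↔
      ¬ P.Solvable n := by
  refine ⟨fun h hs => ?_, fun h u => accepts_false_iff_accepts_true h⟩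
  obtain ⟨u, h1, h2⟩ := exists_accepts_true_not_accepts_false (κ := κ) hs
  exact h2 ((h u).2 h1)

end BlockMachine

/-! ### Descriptions of the block machines -/

namespace BlockState

variable {κ : ℕ} {Y : Type}

/-- The states that the block machine has for every length `n` of the initial chain. -/
def IsCore : BlockState (κ + 2) Y → Prop
  | chain _ => False
  | expect _ _ l => l.length ≤ 3
  | _ => True

instance [Finite Y] : Finite {q : BlockState (κ + 2) Y // q.IsCore} := by
  have : Finite {l : List Y // l.length ≤ 3} := List.finite_length_le Y 3
  refine Finite.of_surjective
    (fun x : (Bool ⊕ (Bool × Bool × {l : List Y // l.length ≤ 3})) ⊕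
        ((Bool × Bool × Bool) ⊕ (Fin (κ + 2) × Bool)) =>
      match x with
      | .inl (.inl i) => (⟨start i, trivial⟩ : {q : BlockState (κ + 2) Y // q.IsCore})
      | .inl (.inr (i, fin, l)) => ⟨expect i fin l.1, l.2⟩
      | .inr (.inl (y, z, r)) => ⟨skip y z r, trivial⟩
      | .inr (.inr (j, r)) => ⟨pad j r, trivial⟩) ?_
  rintro ⟨i | m | ⟨i, fin, l⟩ | ⟨y, z, r⟩ | ⟨j, r⟩, h⟩
  · exact ⟨.inl (.inl i), rfl⟩
  · exact h.elim
  · exact ⟨.inl (.inr (i, fin, ⟨l, h⟩)), rfl⟩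
  · exact ⟨.inr (.inl (y, z, r)), rfl⟩
  · exact ⟨.inr (.inr (j, r)), rfl⟩

/-- The states that are used with an initial chain of length `n`. -/
def IsValid (n : ℕ) (q : BlockState (κ + 2) Y) : Prop :=
  q.IsCore ∨ ∃ m ≤ n, q = chain m

theorem isValid_start (n : ℕ) (i : Bool) : (start i : BlockState (κ + 2) Y).IsValid n :=
  .inl trivial

variable {s : ℕ} (e : {q : BlockState (κ + 2) Y // q.IsCore} ≃ Fin s)

open Classical in
/-- The number of a state: the core states come first, then the chain. The numbering does not depend on
the length of the chain. -/
noncomputable def num (q : BlockState (κ + 2) Y) : ℕ :=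
  if h : q.IsCore then e ⟨q, h⟩ else
    match q with
    | chain m => s + m
    | _ => 0

/-- The state with a given number. -/
def ofNum (i : ℕ) : BlockState (κ + 2) Y :=
  if h : i < s then (e.symm ⟨i, h⟩).1 else chain (i - s)

theorem num_chain (m : ℕ) : num e (chain m) = s + m := dif_neg fun h => h

theorem num_lt_of_isCore {q : BlockState (κ + 2) Y} (h : q.IsCore) : num e q < s := by
  rw [num, dif_pos h]
  exact (e _).2

theorem ofNum_add (m : ℕ) : ofNum e (s + m) = chain m := by
  rw [ofNum, dif_neg (by omega), Nat.add_sub_cancel_left]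

theorem ofNum_num {n : ℕ} {q : BlockState (κ + 2) Y} (h : q.IsValid n) : ofNum e (num e q) = q := by
  rcases h with h | ⟨m, -, rfl⟩
  · rw [ofNum, dif_pos (num_lt_of_isCore e h)]
    simp [num, h]
  · rw [num_chain, ofNum_add]

theorem isCore_ofNum {i : ℕ} (hi : i < s) : (ofNum e i).IsCore := by
  rw [ofNum, dif_pos hi]
  exact (e.symm _).2

theorem num_ofNum (i : ℕ) : num e (ofNum e i) = i := by
  by_cases hi : i < s
  · rw [num, dif_pos (isCore_ofNum e hi)]
    simp [ofNum, hi]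
  · obtain ⟨m, rfl⟩ := Nat.exists_eq_add_of_le (not_lt.1 hi)
    rw [ofNum_add, num_chain]

theorem num_lt {n : ℕ} {q : BlockState (κ + 2) Y} (h : q.IsValid n) : num e q < s + n + 1 := by
  rcases h with h | ⟨m, hm, rfl⟩
  · have := num_lt_of_isCore e h
    omega
  · rw [num_chain]
    omega

theorem isValid_ofNum {n i : ℕ} (hi : i < s + n + 1) : (ofNum e i).IsValid n := by
  by_cases his : i < s
  · exact .inl (isCore_ofNum e his)
  · obtain ⟨m, rfl⟩ := Nat.exists_eq_add_of_le (not_lt.1 his)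
    exact .inr ⟨m, by omega, ofNum_add e m⟩

variable {P : TileSystem Y} {n : ℕ}

theorem IsValid.silent {q q' : BlockState (κ + 2) Y} (hpre : P.pre.length ≤ 3) (h : q.IsValid n)
    (hq : silent P n q = some q') : q'.IsValid n := by
  rcases q with (_ | _) | (_ | m) | ⟨i, _ | _, _ | ⟨b, l⟩⟩ | ⟨_ | _, _ | _, r⟩ | ⟨j, r⟩ <;>
    simp only [BlockState.silent, Option.some.injEq, reduceCtorEq] at hq <;> subst hq
  · exact .inr ⟨n, le_rfl, rfl⟩
  · exact .inl (Nat.zero_le _)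
  · exact .inl hpre
  · exact .inl trivial
  · exact .inl trivial

theorem IsValid.onLetter [DecidableEq Y] {q : BlockState (κ + 2) Y} (h : q.IsValid n)
    (hP : ∀ i t, (P.morphism i t).length ≤ 3) (x : Option Y) : (onLetter P q x).IsValid n := by
  have hend : ∀ i, (P.ending i).length ≤ 3 := fun i => by
    cases i <;> simp [TileSystem.ending]
  rcases q with (_ | _) | (_ | m) | ⟨i, fin, _ | ⟨b, l⟩⟩ | ⟨_ | _, z, r⟩ | ⟨j, r⟩
  · exact h
  · exact h
  · exact h
  · simp only [BlockState.onLetter]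
    split_ifs
    · obtain h | ⟨m', hm', h⟩ := h
      · exact h.elim
      · rw [chain.injEq] at h
        exact .inr ⟨m, by omega, rfl⟩
    · exact .inl trivial
  · cases x with
    | none => exact .inl (hend i)
    | some t => exact .inl (hP i t)
  · simp only [BlockState.onLetter]
    split_ifs
    · obtain h | ⟨m', hm', h⟩ := h
      · exact .inl ((Nat.le_succ _).trans h)
      · simp at h
    · exact .inl trivial
  · cases x <;> exact .inl trivial
  · exact .inl trivial
  · simp only [BlockState.onLetter]
    split_ifs <;> exact .inl trivial

end BlockState

namespace BlockMachine

open BlockState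

variable {κ : ℕ} {Y : Type} [DecidableEq Y] {s M : ℕ} (P : TileSystem Y)
  (e : {q : BlockState (κ + 2) Y // q.IsCore} ≃ Fin s) (ex : Option Y ≃ Fin M)

/-- The number of a state as an element of `Fin`; on states that are not valid the value is immaterial. -/
noncomputable def encode (n : ℕ) (q : BlockState (κ + 2) Y) : Fin (s + n + 1) :=
  Fin.ofNat _ (num e q)

theorem val_encode {n : ℕ} {q : BlockState (κ + 2) Y} (h : q.IsValid n) :
    (encode e n q : ℕ) = num e q :=
  Nat.mod_eq_of_lt (num_lt e h)

theorem ofNum_encode {n : ℕ} {q : BlockState (κ + 2) Y} (h : q.IsValid n) :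
    ofNum e (encode e n q) = q := by
  rw [val_encode e h, ofNum_num e h]

/-- The block machine as a transducer with numbered states and letters, started with the test `i`. -/
noncomputable def transducer (n : ℕ) (i : Bool) :
    Transducer (Fin (s + n + 1)) (fun _ : Fin (κ + 2) => Fin M) :=
  ((blockMachine κ P n).rename ex (encode e n) (fun q => ofNum e q)).toTransducer
    (encode e n (start i)) {encode e n (start true)}

variable {P}

theorem mem_omegaRel_transducer (hpre : P.pre.length ≤ 3)
    (hP : ∀ i t, (P.morphism i t).length ≤ 3) (n : ℕ) (i : Bool) (u : Fin (κ + 2) → ℕ → Fin M) :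
    u ∈ (transducer P e ex n i).omegaRel ↔ Accepts P n (fun j m => ex.symm (u j m)) i := by
  have hrun := fun m => (blockMachine κ P n).run_rename ex (encode e n) (fun q => ofNum e q)
    (fun q' q hq => ofNum_encode e ((isValid_ofNum e q'.2).silent hpre hq))
    (fun q' x => ofNum_encode e ((isValid_ofNum e q'.2).onLetter hP x)) u (encode e n (start i)) m
  simp only [ofNum_encode e (isValid_start n i)] at hrun
  rw [transducer, ReadMachine.mem_omegaRel_toTransducer, Accepts]
  simp only [← hrun, Set.mem_singleton_iff, exists_eq_left]
  have hiff : ∀ q : Fin (s + n + 1), q = encode e n (start true) ↔ ofNum e q = start true := by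
    intro q
    constructor
    · rintro rfl
      exact ofNum_encode e (isValid_start _ _)
    · intro h
      rw [Fin.ext_iff, val_encode e (isValid_start _ _), ← h, num_ofNum]
  simp only [hiff]

theorem omegaRel_transducer_eq_iff (hpre : P.pre.length ≤ 3)
    (hP : ∀ i t, (P.morphism i t).length ≤ 3) (n : ℕ) :
    (transducer P e ex n false).omegaRel = (transducer P e ex n true).omegaRel ↔
      ¬ P.Solvable n := by
  rw [← forall_accepts_iff (κ := κ), Set.ext_iff]
  simp only [mem_omegaRel_transducer e ex hpre hP]
  refine ⟨fun h u => ?_, fun h u => h _⟩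
  simpa using h fun j m => ex (u j m)

variable (P)

/-- The label of a transition that reads the letter with number `x` on tape `j`. -/
def letterLabel (j : Fin (κ + 2)) (x : Fin M) : Fin (κ + 2) → Option ℕ :=
  fun j' => if j' = j then some x else none

/-- The labels and targets of the transitions from a state. -/
def edges (n : ℕ) (q : BlockState (κ + 2) Y) :
    List ((Fin (κ + 2) → Option ℕ) × BlockState (κ + 2) Y) :=
  match silent P n q with
  | some q' => [(fun _ => none, q')]
  | none => (List.finRange M).map fun x => (letterLabel q.comp x, onLetter P q (ex.symm x))

variable {P} in
/-- The numerical form of the transitions, in terms of `edges`. -/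
theorem exists_mem_step_transducer_iff (hpre : P.pre.length ≤ 3)
    (hP : ∀ i t, (P.morphism i t).length ≤ 3) (n : ℕ) (i : Bool)
    (t : ℕ × (Fin (κ + 2) → Option ℕ) × ℕ) :
    (∃ p a q, (p, a, q) ∈ (transducer P e ex n i).step ∧
        t = ((p : ℕ), (fun j => (a j).map Fin.val), (q : ℕ))) ↔
      ∃ p < s + n + 1, ∃ l ∈ edges P ex n (ofNum e p), t = (p, l.1, num e l.2) := by
  constructor
  · rintro ⟨p, a, q, ⟨h1, h2⟩, rfl⟩
    have hv := isValid_ofNum e p.2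
    refine ⟨p, p.2, ?_⟩
    simp only at h1 h2
    change ∀ j, j ≠ (ofNum e p).comp → a j = none at h1
    change ReadMachine.delta _ p (a (ofNum e p).comp) = some q at h2
    unfold edges
    cases hs : silent P n (ofNum e p) with
    | some q' =>
      have heps : ((blockMachine κ P n).rename ex (encode e n) (fun q => ofNum e q)).eps p =
          some (encode e n q') := by
        simp [ReadMachine.rename, blockMachine, hs]
      have hnone : a (ofNum e p).comp = none := by
        by_contra hcon
        obtain ⟨x, hx⟩ := Option.ne_none_iff_exists'.1 hcon
        rw [hx] at h2
        simp [ReadMachine.delta, heps] at h2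
      have hall : ∀ j, a j = none := fun j => by
        by_cases hj : j = (ofNum e p).comp
        · rw [hj, hnone]
        · exact h1 j hj
      rw [hnone, ReadMachine.delta, heps, Option.some.injEq] at h2
      refine ⟨_, List.mem_singleton_self _, ?_⟩
      simp only [hall, Option.map_none, ← h2, val_encode e (hv.silent hpre hs)]
    | none =>
      have heps : ((blockMachine κ P n).rename ex (encode e n) (fun q => ofNum e q)).eps p =
          none := by
        simp [ReadMachine.rename, blockMachine, hs]
      obtain ⟨x, hx⟩ : ∃ x, a (ofNum e p).comp = some x := by
        refine Option.ne_none_iff_exists'.1 fun hcon => ?_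
        rw [hcon] at h2
        simp [ReadMachine.delta, heps] at h2
      rw [hx, ReadMachine.delta, if_pos heps, Option.some.injEq] at h2
      refine ⟨_, List.mem_map.2 ⟨x, List.mem_finRange x, rfl⟩, ?_⟩
      have hlab : (fun j => (a j).map Fin.val) = letterLabel (ofNum e p).comp x := by
        funext j
        by_cases hj : j = (ofNum e p).comp
        · subst hj
          simp [letterLabel, hx]
        · simp [letterLabel, hj, h1 j hj]
      rw [← h2, hlab, ← val_encode e (hv.onLetter hP _)]
      rfl
  · rintro ⟨p, hp, l, hl, rfl⟩
    have hv := isValid_ofNum e hp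
    unfold edges at hl
    cases hs : silent P n (ofNum e p) with
    | some q' =>
      simp only [hs, List.mem_singleton] at hl
      subst hl
      refine ⟨⟨p, hp⟩, fun _ => none, encode e n q', ⟨fun _ _ => rfl, ?_⟩, ?_⟩
      · simp [ReadMachine.delta, ReadMachine.rename, blockMachine, hs]
      · simp [val_encode e (hv.silent hpre hs)]
    | none =>
      simp only [hs, List.mem_map] at hl
      obtain ⟨x, -, rfl⟩ := hl
      refine ⟨⟨p, hp⟩, fun j => if j = (ofNum e p).comp then some x else none,
        encode e n (onLetter P (ofNum e p) (ex.symm x)), ⟨fun j hj => if_neg hj, ?_⟩, ?_⟩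
      · simp [ReadMachine.delta, ReadMachine.rename, blockMachine, hs]
      · rw [val_encode e (hv.onLetter hP _)]
        simp only [Prod.mk.injEq, and_true, true_and]
        funext j
        by_cases hj : j = (ofNum e p).comp <;> simp [letterLabel, hj]

open Classical in
/-- The transitions from core states, apart from the one that leads to the chain; they do not depend
on the length of the chain. -/
noncomputable def coreTransitions : List (ℕ × (Fin (κ + 2) → Option ℕ) × ℕ) :=
  (List.range s).flatMap fun p =>
    if ofNum e p = start false then [] else
      (edges P ex 0 (ofNum e p)).map fun l => (p, l.1, num e l.2)

/-- The labels of the transitions from a state of the chain, with their targets; `none` stands for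
the next state of the chain. -/
noncomputable def chainTransitions : List ((Fin (κ + 2) → Option ℕ) × Option ℕ) :=
  (List.finRange M).map fun x => (letterLabel 1 x,
    if ex.symm x = some P.unit then none else some (num e (skip true (ex.symm x).isSome true)))

/-- The list of all transitions, with a chain of length `n`. -/
noncomputable def transitions (n : ℕ) : List (ℕ × (Fin (κ + 2) → Option ℕ) × ℕ) :=
  coreTransitions P e ex ++
    ((num e (start false), (fun _ => none), s + n) ::
      (s, (fun _ => none), num e (expect false false P.pre)) ::
        (List.range n).flatMap fun m =>
          (chainTransitions P e ex).map fun l => (s + m + 1, l.1, l.2.getD (s + m)))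

theorem mem_transitions_iff (n : ℕ) (t : ℕ × (Fin (κ + 2) → Option ℕ) × ℕ) :
    t ∈ transitions P e ex n ↔
      ∃ p < s + n + 1, ∃ l ∈ edges P ex n (ofNum e p), t = (p, l.1, num e l.2) := by
  have hedges : ∀ q : BlockState (κ + 2) Y, q ≠ start false → edges P ex n q = edges P ex 0 q := by
    intro q hq
    have : silent P n q = silent P 0 q := by
      rcases q with (_ | _) | (_ | m) | ⟨i, _ | _, _ | ⟨b, l⟩⟩ | ⟨_ | _, _ | _, r⟩ | ⟨j, r⟩ <;>
        first | rfl | exact absurd rfl hq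
    simp only [edges, this]
  have hstart : edges P ex n (start false : BlockState (κ + 2) Y) = [(fun _ => none, chain n)] := rfl
  have hzero : edges P ex n (chain 0 : BlockState (κ + 2) Y) =
      [(fun _ => none, expect false false P.pre)] := rfl
  have hsucc : ∀ m, (edges P ex n (chain (m + 1) : BlockState (κ + 2) Y)).map
      (fun l => (s + m + 1, l.1, num e l.2)) =
      (chainTransitions P e ex).map fun l => (s + m + 1, l.1, l.2.getD (s + m)) := by
    intro m
    rw [chainTransitions, List.map_map]
    change List.map _ (List.map _ _) = _
    rw [List.map_map]
    refine List.map_congr_left fun x _ => ?_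
    simp only [Function.comp, onLetter]
    split_ifs
    · rw [num_chain]
      rfl
    · rfl
  have hs : ofNum e s = chain 0 := ofNum_add e 0
  have hs1 : ∀ m, ofNum e (s + m + 1) = chain (m + 1) := fun m => ofNum_add e (m + 1)
  rw [transitions, List.mem_append, List.mem_cons, List.mem_cons, List.mem_flatMap]
  constructor
  · rintro (h | rfl | rfl | ⟨m, hm, h⟩)
    · rw [coreTransitions, List.mem_flatMap] at h
      obtain ⟨p, hp, h⟩ := h
      rw [List.mem_range] at hp
      split_ifs at h with hq
      · simp at h
      · obtain ⟨l, hl, rfl⟩ := List.mem_map.1 h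
        exact ⟨p, by omega, l, by rwa [hedges _ hq], rfl⟩
    · refine ⟨num e (start false), num_lt e (isValid_start _ _), ?_⟩
      rw [ofNum_num e (isValid_start n _), hstart]
      exact ⟨_, List.mem_singleton_self _, by rw [num_chain]⟩
    · refine ⟨s, by omega, ?_⟩
      rw [hs, hzero]
      exact ⟨_, List.mem_singleton_self _, rfl⟩
    · rw [List.mem_range] at hm
      rw [← hsucc, List.mem_map] at h
      obtain ⟨l, hl, rfl⟩ := h
      exact ⟨s + m + 1, by omega, l, by rwa [hs1], rfl⟩
  · rintro ⟨p, hp, l, hl, rfl⟩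
    by_cases hps : p < s
    · by_cases hq : ofNum e p = start false
      · rw [hq, hstart, List.mem_singleton] at hl
        subst hl
        refine .inr (.inl ?_)
        rw [num_chain, ← hq, num_ofNum]
      · refine .inl ?_
        rw [coreTransitions, List.mem_flatMap]
        refine ⟨p, List.mem_range.2 hps, ?_⟩
        rw [if_neg hq, ← hedges _ hq]
        exact List.mem_map.2 ⟨l, hl, rfl⟩
    · obtain ⟨m, rfl⟩ := Nat.exists_eq_add_of_le (not_lt.1 hps)
      cases m with
      | zero =>
        have hl' : l ∈ edges P ex n (ofNum e s) := hl
        rw [hs, hzero, List.mem_singleton] at hl'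
        subst hl'
        exact .inr (.inr (.inl rfl))
      | succ m =>
        refine .inr (.inr (.inr ⟨m, List.mem_range.2 (by omega), ?_⟩))
        rw [← hsucc]
        rw [← Nat.add_assoc, hs1] at hl
        exact List.mem_map.2 ⟨l, hl, rfl⟩

/-- The finite description of `transducer P e ex n i`. -/
noncomputable def code (n : ℕ) (i : Bool) : TransducerCode (κ + 2) :=
  (s + n + 1, num e (start i), transitions P e ex n, [num e (start true)])

variable {P} in
theorem isCodeOf_code (hpre : P.pre.length ≤ 3) (hP : ∀ i t, (P.morphism i t).length ≤ 3)
    (n : ℕ) (i : Bool) :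
    IsCodeOf (m := fun _ => M) (code P e ex n i) (transducer P e ex n i) := by
  refine ⟨rfl, (val_encode e (isValid_start _ _)).symm, fun t => ?_, fun q => ?_⟩
  · rw [exists_mem_step_transducer_iff e ex hpre hP]
    exact mem_transitions_iff P e ex n t
  · change q ∈ [num e (start true)] ↔ ∃ f, f = encode e n (start true) ∧ q = f
    rw [exists_eq_left, List.mem_singleton, val_encode e (isValid_start _ _)]

theorem computable_code (i : Bool) : Computable fun n => code P e ex n i := by
  have hadd : Primrec₂ fun (a b : ℕ) => a + b := Primrec.nat_add
  have hmap : Primrec₂ fun (_ m : ℕ) => (chainTransitions P e ex).map fun l =>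
      ((s + m + 1, l.1, l.2.getD (s + m)) : ℕ × (Fin (κ + 2) → Option ℕ) × ℕ) := by
    have h1 : Primrec fun x : (ℕ × ℕ) × ((Fin (κ + 2) → Option ℕ) × Option ℕ) => s + x.1.2 :=
      hadd.comp (Primrec.const s) (Primrec.snd.comp Primrec.fst)
    refine Primrec.list_map (Primrec.const _) (Primrec.pair (Primrec.succ.comp h1) (Primrec.pair
      (Primrec.fst.comp Primrec.snd) (Primrec.option_getD.comp (Primrec.snd.comp Primrec.snd) h1)))
  have htrans : Primrec fun n => transitions P e ex n := by
    refine Primrec.list_append.comp (Primrec.const _) (Primrec.list_cons.comp ?_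
      (Primrec.list_cons.comp (Primrec.const _) (Primrec.list_flatMap Primrec.list_range hmap)))
    exact Primrec.pair (Primrec.const _) (Primrec.pair (Primrec.const _)
      (hadd.comp (Primrec.const s) Primrec.id))
  exact (Primrec.pair (Primrec.succ.comp (hadd.comp (Primrec.const s) Primrec.id))
    (Primrec.pair (Primrec.const _) (Primrec.pair htrans (Primrec.const _)))).to_comp

end BlockMachine

theorem mainTheorem1 (k : ℕ) (hk : 2 ≤ k) : ¬ BuchiEquivalenceDecidable k := by
  classical
  obtain ⟨κ, rfl⟩ := Nat.exists_eq_add_of_le' hk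
  rintro ⟨decider, hcomp, hdec⟩
  obtain ⟨Y, _, g, h, c, tick, pre, hg, hh, hpre, hnot⟩ := exists_tile_problem_not_computable
  let P : TileSystem Y := ⟨g, h, c, pre, tick⟩
  have hP : ∀ i t, (P.morphism i t).length ≤ 3 := by
    rintro (_ | _) t
    exacts [hh t, hg t]
  obtain ⟨s, ⟨e⟩⟩ := Finite.exists_equiv_fin {q : BlockState (κ + 2) Y // q.IsCore}
  obtain ⟨M, ⟨ex⟩⟩ := Finite.exists_equiv_fin (Option Y)
  have hM : 0 < M := (Nat.zero_le _).trans_lt (ex none).2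
  have hsolv : ∀ n, decider (fun _ => M, BlockMachine.code P e ex n false,
      BlockMachine.code P e ex n true) = true ↔ ¬ P.Solvable n := fun n => by
    rw [← BlockMachine.omegaRel_transducer_eq_iff e ex hpre hP]
    exact hdec (fun _ => M) _ _ _ _ _ _ (fun _ => hM)
      (ReadMachine.isDeterministic_toTransducer _ _ _)
      (ReadMachine.isDeterministic_toTransducer _ _ _)
      (BlockMachine.isCodeOf_code e ex hpre hP n false)
      (BlockMachine.isCodeOf_code e ex hpre hP n true)
  have hcp : ComputablePred fun n => ¬ P.Solvable n := by
    refine ComputablePred.computable_iff.2 ⟨_, hcomp.comp (Computable.pair (Computable.const _)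
      (Computable.pair (BlockMachine.computable_code P e ex false)
        (BlockMachine.computable_code P e ex true))), funext fun n => propext (hsolv n).symm⟩
  refine hnot (hcp.not.of_eq fun n => ?_)
  rw [not_not]
  refine exists_congr fun y => exists_congr fun z => ?_
  constructor
  · intro ht
    refine ⟨?_, ht true⟩
    simpa [TileSystem.Test, P, TileSystem.front, TileSystem.ending, TileSystem.morphism] using
      ht false
  · rintro ⟨h1, h2⟩ (_ | _)
    · simpa [TileSystem.Test, P, TileSystem.front, TileSystem.ending, TileSystem.morphism] using h1
    · exact h2
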